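/- **Notation.** $(ID,\ast)$ is the class of infinitely divisible probability measures on $\mathbb R$. A Lévy measure is a Borel measure $M$ on $\mathbb R\setminus\{0\}$ with $\int\min(1,x^2)\,M(dx)<\infty$. For $a\in\mathbb R$, $\sigma^2\ge 0$ and a Lévy measure $M$, we write $\mu=[a,\sigma^2,M]$ if the characteristic function of $\mu$ is $$\phi_\mu(t)=\exp\Big(ita-\tfrac12\sigma^2t^2+\int_{\mathbb R\setminus\{0\}}\big(e^{itx}-1-\tfrac{itx}{1+x^2}\big)M(dx)\Big),\quad t\in\mathbb R.$$ For $k\ge 1$ let $\tau_k(t)=\frac1{(k-1)!}\int_0^t(-\log v)^{k-1}dv$, $0\le t\le 1$. For $\mu\in(ID,\ast)$ let $I_k(\mu)$ be the law of the random integral $\int_{(0,1]}t\,dY(\tau_k(t))$, where $Y$ is the Lévy process such that $Y(1)$ has law $\mu$ (the background driving measure); the integral is understood as the limit in law of its Riemann–Stieltjes sums. Let $(\mathcal U^{<k>},\ast)=\{I_k(\mu):\mu\in(ID,\ast)\}$ be the class of $k$-times s-selfdecomposable measures. For a probability measure $\rho$ on $\mathbb R$ let $F_\rho(z)=\big(\int\frac{\rho(dx)}{z-x}\big)^{-1}$,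 $\Im z>0$. The Voiculescu transform is $V_\rho(w)=F_\rho^{-1}(w)-w$, defined near $\infty$ through the inverse of $F_\rho$ on a truncated cone $\{\Im z>\beta,\ |\Re z|<\alpha\,\Im z\}$ and continued analytically to the upper half-plane; statements about $V_\rho(it)$, $t>0$, include that this continuation exists. A probability measure $\tilde\nu$ is the free counterpart of $\nu\in(ID,\ast)$ if $$V_{\tilde\nu}(it)=it^2\int_0^\infty\log\phi_\nu(-u)\,e^{-tu}\,du\quad\text{for all }t>0,$$ where $\log\phi_\nu$ is the continuous logarithm vanishing at $0$. The class of free counterparts of the elements of $(\mathcal U^{<k>},\ast)$ is denoted by $(\mathcal U^{<k>},\boxplus)$. Finally, $\Phi(z,s,v)=\sum_{n\ge0}z^n/(v+n)^s$, $|z|<1$, continued analytically to $z\in\mathbb C\setminus[1,\infty)$, is the Hurwitz–Lerch function. **Proposition.** Let $k\ge 1$. (a) Let $\mu=[a,\sigma^2,M]$ and $\nu=I_k(\mu)\in(\mathcal U^{<k>},\ast)$. A probability measure $\tilde\nu$ is the free counterpart of $\nu$ if and only if, for all $t>0$, $$V_{\tilde\nu}(it)=\frac a{2^k}+\frac{\sigma^2}{3^k}\frac1{it}+\int_{\mathbb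 R\setminus\{0\}}x\Big[\Phi\big(\tfrac x{it},k,2\big)-\frac1{1+x^2}\frac1{2^k}\Big]M(dx);\qquad(1)$$ equivalently, if and only if, for all $t>0$, $$V_{\tilde\nu}(it)=\frac a{2^k}+\int_{\mathbb R}\Big[\Phi\big(\tfrac x{it},k,2\big)-\frac1{1+x^2}\frac1{2^k}\Big]\frac{1+x^2}x\,m(dx),\qquad(2)$$ where $m(dx)=\frac{x^2}{1+x^2}M(dx)$ on $\mathbb R\setminus\{0\}$ and $m(\{0\})=\sigma^2$. Here $m$ is a finite Borel measure, the value of the integrand in (2) at $x=0$ is $(3^k\,it)^{-1}$, which is its limit as $x\to0$, and the integrals in (1) and (2) converge absolutely. (b) Consequently, a probability measure $\tilde\nu$ belongs to $(\mathcal U^{<k>},\boxplus)$ if and only if (1) holds for all $t>0$ with some $a\in\mathbb R$, $\sigma^2\ge0$ and Lévy measure $M$; equivalently, if and only if (2) holds for all $t>0$ with some $a\in\mathbb R$ and some finite Borel measure $m$ on $\mathbb R$. -/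

import Mathlib

open MeasureTheory Filter Topology
open scoped NNReal

namespace UrbanikFree

noncomputable section

/-! ### Classical infinite divisibility -/

/-- The law of `∑ j, c j * X j`, where the `X j` are independent and `X j` has law `μ j`. -/
def lawOfSum {n : ℕ} (c : Fin n → ℝ) (μ : Fin n → ProbabilityMeasure ℝ) : ProbabilityMeasure ℝ :=
  (ProbabilityMeasure.pi μ).map (f := fun x : Fin n → ℝ => ∑ j, c j * x j)
    (Measurable.aemeasurable (by fun_prop))

/-- `μ ∈ (ID, ∗)`: for every `n ≥ 1`, `μ` is the law of a sum of `n` i.i.d. random variables. -/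
def IsInfinitelyDivisible (μ : ProbabilityMeasure ℝ) : Prop :=
  ∀ n : ℕ, 1 ≤ n → ∃ ρ : ProbabilityMeasure ℝ, lawOfSum (fun _ : Fin n => 1) (fun _ => ρ) = μ

/-- `M` is a Lévy (spectral) measure on `ℝ ∖ {0}`, seen as a measure on `ℝ` without mass at `0`. -/
def IsLevyMeasure (M : Measure ℝ) : Prop :=
  M {0} = 0 ∧ ∫⁻ x, ENNReal.ofReal (min 1 (x ^ 2)) ∂M < ⊤

/-- `μ = [a, σ², M]`: the Lévy–Khintchine formula with centering function `x / (1 + x ^ 2)`.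
Since `M {0} = 0`, the integral over `ℝ` is the one over `ℝ ∖ {0}`. -/
def HasLevyTriplet (μ : ProbabilityMeasure ℝ) (a : ℝ) (σsq : ℝ≥0) (M : Measure ℝ) : Prop :=
  IsLevyMeasure M ∧
    ∀ t : ℝ, charFun (μ : Measure ℝ) t =
      Complex.exp (Complex.I * t * a - (1 / 2 : ℂ) * ((σsq : ℝ) : ℂ) * (t : ℂ) ^ 2
        + ∫ x : ℝ, (Complex.exp (Complex.I * t * x) - 1
            - Complex.I * t * x / (1 + (x : ℂ) ^ 2)) ∂M)

/-- The finite measure `m` with `m(dx) = x² / (1 + x²) M(dx)` on `ℝ ∖ {0}` and `m {0} = σ²`. -/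
def khintchineMeasure (σsq : ℝ≥0) (M : Measure ℝ) : Measure ℝ :=
  M.withDensity (fun x => ENNReal.ofReal (x ^ 2 / (1 + x ^ 2))) + σsq • Measure.dirac 0

/-- `ψ = log φ_μ`: the continuous logarithm, vanishing at `0`, of the characteristic function. -/
def IsLogCharFun (μ : ProbabilityMeasure ℝ) (ψ : ℝ → ℂ) : Prop :=
  Continuous ψ ∧ ψ 0 = 0 ∧ ∀ u : ℝ, Complex.exp (ψ u) = charFun (μ : Measure ℝ) u

/-! ### Random integrals with respect to Lévy processes -/

/-- `Y t` (`t ≥ 0`) are the one-dimensional laws of a Lévy process: a weakly continuous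
convolution semigroup of probability measures. By independence and stationarity of the increments
they determine the law of the process: the increments of the process over disjoint intervals
`(s, t]` are independent with laws `Y (t - s)`. -/
structure IsLevySemigroup (Y : ℝ≥0 → ProbabilityMeasure ℝ) : Prop where
  zero : (Y 0 : Measure ℝ) = Measure.dirac 0
  add : ∀ s t : ℝ≥0, (Y (s + t) : Measure ℝ) = (Y s : Measure ℝ).conv (Y t : Measure ℝ)
  continuous : Continuous Y

/-- The `j`-th point of the partition of `[a, b]` into `n` intervals of equal length. -/
def partitionPoint (a b : ℝ) (n j : ℕ) : ℝ := a + (b - a) * ((j : ℝ) / (n : ℝ))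

/-- For a Lévy process with one-dimensional laws `Y` and a nondecreasing time change `r`, the law
of the Riemann–Stieltjes sum `∑ j, h (t_{j+1}) * (Y (r (t_{j+1})) - Y (r (t_j)))` over the
partition of `(a, b]` into `n` intervals of equal length. -/
def riemannSumLaw (h r : ℝ → ℝ) (a b : ℝ) (Y : ℝ≥0 → ProbabilityMeasure ℝ) (n : ℕ) :
    ProbabilityMeasure ℝ :=
  lawOfSum (fun j : Fin n => h (partitionPoint a b n ((j : ℕ) + 1)))
    (fun j : Fin n =>
      Y (r (partitionPoint a b n ((j : ℕ) + 1)) - r (partitionPoint a b n j)).toNNReal)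

/-- `ρ = I^{h,r}_{(a,b]}(μ)`, i.e. `ρ` is the law of `∫_{(a,b]} h(t) dY(r(t))` where `Y` is the Lévy
process such that `Y(1)` has law `μ` (for `h` continuous and `r` continuous, nondecreasing):
the Riemann–Stieltjes sums converge in law to `ρ`. -/
def IsRandomIntegral (h r : ℝ → ℝ) (a b : ℝ) (μ ρ : ProbabilityMeasure ℝ) : Prop :=
  ∃ Y : ℝ≥0 → ProbabilityMeasure ℝ, IsLevySemigroup Y ∧ Y 1 = μ ∧
    Tendsto (fun n : ℕ => riemannSumLaw h r a b Y n) atTop (𝓝 ρ)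

/-- The time change `τ_k(t) = (1 / (k-1)!) ∫_0^t (-log v)^{k-1} dv`. -/
def timeChange (k : ℕ) (t : ℝ) : ℝ :=
  (1 / ((k - 1).factorial : ℝ)) * ∫ v in (0 : ℝ)..t, (-Real.log v) ^ (k - 1)

/-- `ρ` is the law of `∫_{(0,1]} t dY(τ_k(t))`, where `Y(1)` has law `μ`. -/
def IsTimeChangedIntegral (k : ℕ) (μ ρ : ProbabilityMeasure ℝ) : Prop :=
  IsRandomIntegral (fun t => t) (timeChange k) 0 1 μ ρ

/-- The class `(U^{<k>}, ∗) = I^{t, τ_k(t)}_{(0,1]}(ID)` of `k`-times s-selfdecomposable measures. -/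
def sSelfdecomposable (k : ℕ) : Set (ProbabilityMeasure ℝ) :=
  {ρ | ∃ μ : ProbabilityMeasure ℝ, IsInfinitelyDivisible μ ∧ IsTimeChangedIntegral k μ ρ}

/-! ### Voiculescu transforms and free counterparts -/

/-- The reciprocal Cauchy transform `F_ν = 1 / G_ν`, where `G_ν(z) = ∫ ν(dx) / (z - x)`. -/
def reciprocalCauchy (ν : ProbabilityMeasure ℝ) (z : ℂ) : ℂ :=
  (∫ x : ℝ, (z - (x : ℂ))⁻¹ ∂(ν : Measure ℝ))⁻¹

/-- The truncated cone `{x + i y : y > β, |x| < α y}`. -/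
def truncatedCone (α β : ℝ) : Set ℂ := {z : ℂ | β < z.im ∧ |z.re| < α * z.im}

/-- `V` is the Voiculescu transform of `ν`, on the whole upper half-plane: `V` is analytic there and
on some truncated cone `F_ν` is invertible with `V(w) = F_ν⁻¹(w) - w` for `w = F_ν(z)`.
(The displayed equation forces `F_ν` to be injective on the cone, and, by analyticity, it determines
`V` on the upper half-plane.) -/
def IsVoiculescuTransform (ν : ProbabilityMeasure ℝ) (V : ℂ → ℂ) : Prop :=
  DifferentiableOn ℂ V {z : ℂ | 0 < z.im} ∧
    ∃ α > 0, ∃ β > 0, ∀ z ∈ truncatedCone α β,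
      V (reciprocalCauchy ν z) = z - reciprocalCauchy ν z

/-- The Voiculescu transform of `ν` exists on the upper half-plane, and `V_ν(i t) = f t` for all
`t > 0`. -/
def VoiculescuOnAxis (ν : ProbabilityMeasure ℝ) (f : ℝ → ℂ) : Prop :=
  ∃ V : ℂ → ℂ, IsVoiculescuTransform ν V ∧ ∀ t : ℝ, 0 < t → V (Complex.I * t) = f t

/-- `ν'` is the free-probability counterpart of `ν`:
`V_{ν'}(i t) = i t² ∫_0^∞ log φ_ν(-u) e^{-t u} du` for all `t > 0`. -/
def IsFreeCounterpart (ν ν' : ProbabilityMeasure ℝ) : Prop :=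
  ∃ ψ : ℝ → ℂ, IsLogCharFun ν ψ ∧
    (∀ t : ℝ, 0 < t →
      IntegrableOn (fun u : ℝ => ψ (-u) * Complex.exp (-(t * u : ℂ))) (Set.Ioi 0)) ∧
    VoiculescuOnAxis ν' (fun t => Complex.I * (t : ℂ) ^ 2 *
      ∫ u in Set.Ioi (0 : ℝ), ψ (-u) * Complex.exp (-(t * u : ℂ)))

/-- The class `(U^{<k>}, ⊞)` of free counterparts of the elements of `(U^{<k>}, ∗)`. -/
def freeSSelfdecomposable (k : ℕ) : Set (ProbabilityMeasure ℝ) :=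
  {ν' | ∃ ν ∈ sSelfdecomposable k, IsFreeCounterpart ν ν'}

/-! ### The Hurwitz–Lerch function and the kernels -/

/-- `f` is the analytic continuation to `ℂ ∖ [1, ∞)` of the Hurwitz–Lerch series
`∑ z ^ n / (v + n) ^ s`, `|z| < 1`. -/
def IsHurwitzLerch (s v : ℂ) (f : ℂ → ℂ) : Prop :=
  DifferentiableOn ℂ f {z : ℂ | ¬ (1 ≤ z.re ∧ z.im = 0)} ∧
    ∀ z : ℂ, ‖z‖ < 1 → HasSum (fun n : ℕ => z ^ n / (v + n) ^ s) (f z)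

open Classical in
/-- The Hurwitz–Lerch function `Φ(z, s, v)` on `ℂ ∖ [1, ∞)`. -/
def hurwitzLerch (z s v : ℂ) : ℂ :=
  if hf : ∃ f : ℂ → ℂ, IsHurwitzLerch s v f then hf.choose z else 0

/-- `Φ(x / (i t), k, 2) - 2^{-k} / (1 + x²)`. -/
def bracket (k : ℕ) (t x : ℝ) : ℂ :=
  hurwitzLerch ((x : ℂ) / (Complex.I * t)) k 2 - 1 / (1 + (x : ℂ) ^ 2) * (1 / 2 ^ k)

/-- The integrand `[Φ(x / (i t), k, 2) - 2^{-k} / (1 + x²)] (1 + x²) / x`, with the value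
`1 / (3^k i t)` at `x = 0`. -/
def khintchineKernel (k : ℕ) (t x : ℝ) : ℂ :=
  if x = 0 then 1 / (3 ^ k * (Complex.I * t)) else bracket k t x * ((1 + (x : ℂ) ^ 2) / x)

end

end UrbanikFree

/-! Let `ψ` be the exponent of the driving law. Increments over disjoint intervals are independent,
so a Riemann–Stieltjes sum has as exponent a Riemann sum of v ↦ ψ(uv) against dτ_k. Hence log φ_ν(u)
= ∫ ψ(uv) dτ_k(v) (`charFun_of_tendsto_riemannSumLaw`). The density of dτ_k is (-log
v)^(k-1)/(k-1)!, and v = e^(-s) turns its moments into gamma integrals: ∫ v^p dτ_k = (p+1)^(-k)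
(`integral_pow_timeMeasure`).

The formula defining the free counterpart is linear in log φ_ν. Writing ψ in Khintchine's form, as a
drift plus a kernel integrated against the finite measure m, Fubini reduces everything to one
elementary Laplace transform in u for fixed v and x (`laplace_levyKernel`), with result v(x -
iv/t)/(1 + ivx/t). Its integral over dτ_k is the kernel in (2), because Φ(z,k,2) = ∫ v/(1 - zv)
dτ_k(v): expand geometrically and continue analytically (`hurwitzLerch_eq_lerchIntegral`). The first
moment of dτ_k produces 2^(-k), the second 3^(-k). So the function on the imaginary axis prescribed
by the counterpart relation equals the right side of (2) (`laplace_timeExponent`), and no property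
of Voiculescu transforms is needed (`isFreeCounterpart_iff`).

Part (b) also needs that the pairs (a, m) are exactly the exponents available: the Lévy–Khintchine
formula for convolution semigroups (`IsLevySemigroup.exists_levyExponent`), its converse
(`exists_charFun_eq_exp_levyExponent`), and existence of the random integral for each pair
(`exists_mem_sSelfdecomposable`). Formulas (1) and (2) are matched by moving between (σ², M) and m.
-/

namespace UrbanikFree

/-! ### The measure `dτ_k` on `(0, 1]` -/

/-- The density of the time change `τ_k`. -/
noncomputable def timeDensity (k : ℕ) (v : ℝ) : ℝ :=
  (-Real.log v) ^ (k - 1) / ((k - 1).factorial : ℝ)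

/-- The measure on `(0, 1]` with distribution function `τ_k`. -/
noncomputable def timeMeasure (k : ℕ) : Measure ℝ :=
  (volume.restrict (Set.Ioc 0 1)).withDensity (fun v => ENNReal.ofReal (timeDensity k v))

lemma measurable_timeDensity (k : ℕ) : Measurable (timeDensity k) := by
  unfold timeDensity
  fun_prop

lemma timeDensity_nonneg (k : ℕ) {v : ℝ} (hv : v ∈ Set.Ioc (0 : ℝ) 1) : 0 ≤ timeDensity k v := by
  have : 0 ≤ -Real.log v := by
    have := Real.log_nonpos hv.1.le hv.2
    linarith
  unfold timeDensity
  positivity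

lemma image_exp_neg_Ioi : (fun s : ℝ => Real.exp (-s)) '' Set.Ioi 0 = Set.Ioo 0 1 := by
  ext v
  constructor
  · rintro ⟨s, hs, rfl⟩
    exact ⟨Real.exp_pos _, Real.exp_lt_one_iff.2 (by simpa using hs)⟩
  · rintro ⟨h0, h1⟩
    refine ⟨-Real.log v, ?_, ?_⟩
    · simpa using Real.log_neg h0 h1
    · simp [Real.exp_log h0]

lemma hasDerivAt_exp_neg (s : ℝ) :
    HasDerivAt (fun s : ℝ => Real.exp (-s)) (-Real.exp (-s)) s := by
  simpa using (hasDerivAt_neg s).exp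

/-- The Jacobian e^(-s) of v = e^(-s) raises the rate of the gamma integral from p to p + 1. -/
lemma smul_exp_neg_eq (k p : ℕ) (s : ℝ) :
    |(-Real.exp (-s))| • ((Real.exp (-s)) ^ p * timeDensity k (Real.exp (-s)))
      = (s ^ (k - 1) * Real.exp (-((p + 1 : ℕ) * s))) / ((k - 1).factorial : ℝ) := by
  rw [abs_neg, abs_of_pos (Real.exp_pos _), smul_eq_mul, timeDensity, Real.log_exp, neg_neg,
    ← Real.exp_nat_mul]
  have : Real.exp (-((p + 1 : ℕ) * s)) = Real.exp (-s) * Real.exp (p * -s) := by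
    rw [← Real.exp_add]
    push_cast
    ring_nf
  rw [this]
  ring

lemma injOn_exp_neg : Set.InjOn (fun s : ℝ => Real.exp (-s)) (Set.Ioi 0) := fun a _ b _ h => by
  simpa using h

lemma integrableOn_pow_mul_exp (k : ℕ) {r : ℝ} (hr : 0 < r) :
    IntegrableOn (fun s : ℝ => s ^ k * Real.exp (-(r * s))) (Set.Ioi 0) := by
  have := integrableOn_rpow_mul_exp_neg_mul_rpow (p := 1) (s := k) (b := r)
    (by have : (0 : ℝ) ≤ k := k.cast_nonneg
        linarith) one_pos hr
  simpa using this

lemma integral_pow_mul_exp (k : ℕ) {r : ℝ} (hr : 0 < r) :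
    ∫ s in Set.Ioi (0 : ℝ), s ^ k * Real.exp (-(r * s)) = (k.factorial : ℝ) / r ^ (k + 1) := by
  have := Real.integral_rpow_mul_exp_neg_mul_Ioi (a := k + 1) (r := r) (by positivity) hr
  rw [Real.Gamma_nat_eq_factorial] at this
  simp only [add_sub_cancel_right, Real.rpow_natCast] at this
  rw [this, ← Nat.cast_succ, Real.rpow_natCast, one_div, inv_pow, Nat.succ_eq_add_one]
  ring

lemma integrableOn_pow_mul_timeDensity (k p : ℕ) :
    IntegrableOn (fun v => v ^ p * timeDensity k v) (Set.Ioc 0 1) := by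
  rw [integrableOn_Ioc_iff_integrableOn_Ioo, ← image_exp_neg_Ioi,
    integrableOn_image_iff_integrableOn_abs_deriv_smul measurableSet_Ioi
      (fun x _ => (hasDerivAt_exp_neg x).hasDerivWithinAt) injOn_exp_neg]
  simp_rw [smul_exp_neg_eq]
  exact (integrableOn_pow_mul_exp (k - 1) (by positivity)).div_const _

/-- After v = e^(-s) this is Γ(k) / ((k-1)! (p+1)^k). It fails for k = 0, where truncated
subtraction makes the density that of k = 1. -/
lemma setIntegral_pow_mul_timeDensity {k : ℕ} (hk : 1 ≤ k) (p : ℕ) :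
    ∫ v in Set.Ioc 0 1, v ^ p * timeDensity k v = 1 / ((p : ℝ) + 1) ^ k := by
  rw [integral_Ioc_eq_integral_Ioo, ← image_exp_neg_Ioi,
    integral_image_eq_integral_abs_deriv_smul measurableSet_Ioi
      (fun x _ => (hasDerivAt_exp_neg x).hasDerivWithinAt) injOn_exp_neg]
  simp_rw [smul_exp_neg_eq]
  rw [integral_div, integral_pow_mul_exp (k - 1) (by positivity), Nat.sub_add_cancel hk]
  have : ((k - 1).factorial : ℝ) ≠ 0 := by positivity
  push_cast
  field_simp

lemma integrableOn_timeDensity (k : ℕ) : IntegrableOn (timeDensity k) (Set.Ioc 0 1) := by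
  simpa using integrableOn_pow_mul_timeDensity k 0

instance isFiniteMeasure_timeMeasure (k : ℕ) : IsFiniteMeasure (timeMeasure k) :=
  isFiniteMeasure_withDensity_ofReal (integrableOn_timeDensity k).2

lemma ae_mem_Ioc_timeMeasure (k : ℕ) : ∀ᵐ v ∂timeMeasure k, v ∈ Set.Ioc (0 : ℝ) 1 :=
  (withDensity_absolutelyContinuous _ _).ae_le (ae_restrict_mem measurableSet_Ioc)

lemma integral_timeMeasure {E : Type*} [NormedAddCommGroup E] [NormedSpace ℝ E] (k : ℕ)
    (f : ℝ → E) :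
    ∫ v, f v ∂timeMeasure k = ∫ v in Set.Ioc 0 1, timeDensity k v • f v := by
  unfold timeMeasure
  rw [integral_withDensity_eq_integral_toReal_smul (measurable_timeDensity k).ennreal_ofReal
    (by simp)]
  refine setIntegral_congr_fun measurableSet_Ioc fun v hv => ?_
  simp only [ENNReal.toReal_ofReal (timeDensity_nonneg k hv)]

lemma integrable_timeMeasure_of_norm_le {E : Type*} [NormedAddCommGroup E] {k : ℕ} {f : ℝ → E}
    (hf : AEStronglyMeasurable f (timeMeasure k)) (C : ℝ)
    (hC : ∀ v ∈ Set.Ioc (0 : ℝ) 1, ‖f v‖ ≤ C) : Integrable f (timeMeasure k) :=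
  Integrable.of_bound hf C ((ae_mem_Ioc_timeMeasure k).mono hC)

lemma integral_pow_timeMeasure {k : ℕ} (hk : 1 ≤ k) (p : ℕ) :
    ∫ v, v ^ p ∂timeMeasure k = 1 / ((p : ℝ) + 1) ^ k := by
  rw [integral_timeMeasure, ← setIntegral_pow_mul_timeDensity hk p]
  simp only [smul_eq_mul, mul_comm]

lemma integral_ofReal_pow_timeMeasure {k : ℕ} (hk : 1 ≤ k) (p : ℕ) :
    ∫ v, (v : ℂ) ^ p ∂timeMeasure k = 1 / ((p : ℂ) + 1) ^ k := by
  have := congrArg (fun r : ℝ => (r : ℂ)) (integral_pow_timeMeasure hk p)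
  simp only [← integral_complex_ofReal] at this
  push_cast at this
  exact this

/-- Lets the time increments in the Riemann–Stieltjes sums be read as masses of cells. -/
lemma timeChange_sub (k : ℕ) {s t : ℝ} (hs : 0 ≤ s) (hst : s ≤ t) (ht : t ≤ 1) :
    timeChange k t - timeChange k s = (timeMeasure k).real (Set.Ioc s t) := by
  have hI : IntervalIntegrable (fun v => (-Real.log v) ^ (k - 1)) volume 0 1 := by
    rw [intervalIntegrable_iff_integrableOn_Ioc_of_le zero_le_one]
    have := (integrableOn_timeDensity k).mul_const ((k - 1).factorial : ℝ)
    simp only [timeDensity] at this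
    field_simp at this
    exact this
  have h1 : IntervalIntegrable (fun v => (-Real.log v) ^ (k - 1)) volume 0 t :=
    hI.mono_set (by
      rw [Set.uIcc_of_le (hs.trans hst), Set.uIcc_of_le zero_le_one]
      exact Set.Icc_subset_Icc le_rfl ht)
  have h2 : IntervalIntegrable (fun v => (-Real.log v) ^ (k - 1)) volume 0 s :=
    hI.mono_set (by
      rw [Set.uIcc_of_le hs, Set.uIcc_of_le zero_le_one]
      exact Set.Icc_subset_Icc le_rfl (hst.trans ht))
  have hsub : Set.Ioc s t ⊆ Set.Ioc 0 1 := Set.Ioc_subset_Ioc hs ht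
  rw [timeChange, timeChange, ← mul_sub, intervalIntegral.integral_interval_sub_left h1 h2,
    intervalIntegral.integral_of_le hst, ← integral_const_mul]
  have h3 : (timeMeasure k).real (Set.Ioc s t)
      = ∫ v, (Set.Ioc s t).indicator (fun _ => (1 : ℝ)) v ∂timeMeasure k := by
    rw [integral_indicator_const _ measurableSet_Ioc]; simp
  rw [h3, integral_timeMeasure]
  have h4 : ∀ v, timeDensity k v • (Set.Ioc s t).indicator (fun _ => (1 : ℝ)) v
      = (Set.Ioc s t).indicator (timeDensity k) v := fun v => by
    by_cases hv : v ∈ Set.Ioc s t <;> simp [hv]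
  simp_rw [h4]
  rw [integral_indicator measurableSet_Ioc, Measure.restrict_restrict measurableSet_Ioc,
    Set.inter_eq_left.2 hsub]
  refine setIntegral_congr_fun measurableSet_Ioc fun v _ => ?_
  simp only [timeDensity]
  ring

/-! ### The Hurwitz–Lerch function as an integral -/

/-- The reflection z ↦ 1 - z carries the cut plane to the slit plane, which is open and star-shaped
about 1. -/
lemma one_sub_mem_slitPlane_iff (z : ℂ) :
    1 - z ∈ Complex.slitPlane ↔ z ∈ {z : ℂ | ¬ (1 ≤ z.re ∧ z.im = 0)} := by
  simp only [Complex.mem_slitPlane_iff, Complex.sub_re, Complex.one_re, Complex.sub_im,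
    Complex.one_im, zero_sub, ne_eq, neg_eq_zero, Set.mem_ofPred_eq, sub_pos, not_and_or, not_le]

lemma isOpen_cutPlane : IsOpen {z : ℂ | ¬ (1 ≤ z.re ∧ z.im = 0)} := by
  have : {z : ℂ | ¬ (1 ≤ z.re ∧ z.im = 0)} = (fun z => 1 - z) ⁻¹' Complex.slitPlane := by
    ext z; exact (one_sub_mem_slitPlane_iff z).symm
  rw [this]
  exact Complex.isOpen_slitPlane.preimage (by fun_prop)

lemma isPreconnected_cutPlane : IsPreconnected {z : ℂ | ¬ (1 ≤ z.re ∧ z.im = 0)} := by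
  have : {z : ℂ | ¬ (1 ≤ z.re ∧ z.im = 0)} = (fun z => 1 - z) '' Complex.slitPlane := by
    ext z
    rw [← one_sub_mem_slitPlane_iff]
    exact ⟨fun h => ⟨1 - z, h, by ring⟩, by rintro ⟨w, hw, rfl⟩; simpa using hw⟩
  rw [this]
  exact (Complex.starConvex_one_slitPlane.isPathConnected
    Complex.one_mem_slitPlane).isConnected.isPreconnected.image _ (by fun_prop)

lemma one_sub_mul_ne_zero {z : ℂ} (hz : z ∈ {z : ℂ | ¬ (1 ≤ z.re ∧ z.im = 0)}) {v : ℝ}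
    (hv : v ∈ Set.Icc (0 : ℝ) 1) : 1 - z * v ≠ 0 := by
  intro h
  have hzv : z * v = 1 := (sub_eq_zero.1 h).symm
  have hv0 : v ≠ 0 := by rintro rfl; simp at hzv
  have hre : z.re * v = 1 := by simpa using congrArg Complex.re hzv
  have him : z.im = 0 := by simpa [hv0] using congrArg Complex.im hzv
  have hvp : 0 < v := lt_of_le_of_ne hv.1 (Ne.symm hv0)
  refine hz ⟨?_, him⟩
  by_contra! hlt
  nlinarith [hv.2]

/-- The integral representation of `Φ(z, k, 2)`. -/
noncomputable def lerchIntegral (k : ℕ) (z : ℂ) : ℂ :=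
  ∫ v : ℝ, (v : ℂ) / (1 - z * v) ∂timeMeasure k

lemma differentiableOn_lerchIntegral (k : ℕ) :
    DifferentiableOn ℂ (lerchIntegral k) {z : ℂ | ¬ (1 ≤ z.re ∧ z.im = 0)} := by
  intro z₀ hz₀
  obtain ⟨ε, hε, hball⟩ := Metric.nhds_basis_closedBall.mem_iff.1 (isOpen_cutPlane.mem_nhds hz₀)
  -- Compactness of ball × [0, 1] keeps the denominator away from zero uniformly, which dominates
  -- the derivative of the integrand by 1 / c².
  obtain ⟨c, hc, hcb⟩ : ∃ c > 0, ∀ z ∈ Metric.closedBall z₀ ε, ∀ v ∈ Set.Icc (0 : ℝ) 1,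
      c ≤ ‖1 - z * v‖ := by
    have hcomp : IsCompact (Metric.closedBall z₀ ε ×ˢ Set.Icc (0 : ℝ) 1) :=
      (isCompact_closedBall z₀ ε).prod isCompact_Icc
    obtain ⟨p, hp, hmin⟩ := hcomp.exists_isMinOn
      ⟨(z₀, 0), Metric.mem_closedBall_self hε.le, by simp⟩
      (f := fun p : ℂ × ℝ => ‖1 - p.1 * p.2‖) (by fun_prop)
    refine ⟨‖1 - p.1 * p.2‖, norm_pos_iff.2 (one_sub_mul_ne_zero (hball hp.1) hp.2), ?_⟩
    exact fun z hz v hv => hmin (show (z, v) ∈ _ from ⟨hz, hv⟩)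
  refine (hasDerivAt_integral_of_dominated_loc_of_deriv_le
    (F' := fun z (v : ℝ) => (v : ℂ) ^ 2 / (1 - z * v) ^ 2) (bound := fun _ => 1 / c ^ 2)
    (Metric.closedBall_mem_nhds z₀ hε) ?_ ?_ ?_ ?_ ?_
    ?_).2.differentiableAt.differentiableWithinAt
  · exact Eventually.of_forall fun z => Measurable.aestronglyMeasurable (by fun_prop)
  · refine integrable_timeMeasure_of_norm_le
      (Measurable.aestronglyMeasurable (by fun_prop)) (1 / c) fun v hv => ?_
    have h1 := hcb z₀ (Metric.mem_closedBall_self hε.le) v (Set.Ioc_subset_Icc_self hv)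
    rw [norm_div]
    have : ‖(v : ℂ)‖ ≤ 1 := by simpa [abs_of_pos hv.1] using hv.2
    gcongr
  · exact Measurable.aestronglyMeasurable (by fun_prop)
  · filter_upwards [ae_mem_Ioc_timeMeasure k] with v hv z hz
    have h1 := hcb z hz v (Set.Ioc_subset_Icc_self hv)
    rw [norm_div, norm_pow, norm_pow]
    have : ‖(v : ℂ)‖ ^ 2 ≤ 1 := by
      have : ‖(v : ℂ)‖ ≤ 1 := by simpa [abs_of_pos hv.1] using hv.2
      exact pow_le_one₀ (norm_nonneg _) this
    gcongr
  · exact integrable_const _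
  · filter_upwards [ae_mem_Ioc_timeMeasure k] with v hv z hz
    have hne := one_sub_mul_ne_zero (hball hz) (Set.Ioc_subset_Icc_self hv)
    have h1 : HasDerivAt (fun z : ℂ => 1 - z * v) (-(v : ℂ)) z := by
      simpa using ((hasDerivAt_id z).mul_const (v : ℂ)).const_sub 1
    convert! (hasDerivAt_const z (v : ℂ)).div h1 hne using 1
    ring

/-- Expand v / (1 - zv) = ∑ zⁿ vⁿ⁺¹ and integrate termwise; the moment of order n + 1 is 1 / (n +
2)^k, which explains the parameter 2. -/
lemma hasSum_lerchIntegral {k : ℕ} (hk : 1 ≤ k) {z : ℂ} (hz : ‖z‖ < 1) :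
    HasSum (fun n : ℕ => z ^ n / ((2 : ℂ) + n) ^ (k : ℂ)) (lerchIntegral k z) := by
  have hmeas : ∀ n : ℕ, Measurable (fun v : ℝ => z ^ n * (v : ℂ) ^ (n + 1)) := fun n => by
    fun_prop
  have hbound : ∀ n : ℕ, ∀ v ∈ Set.Ioc (0 : ℝ) 1, ‖z ^ n * (v : ℂ) ^ (n + 1)‖ ≤ ‖z‖ ^ n := by
    intro n v hv
    have h1 : ‖(v : ℂ)‖ ≤ 1 := by simpa [abs_of_pos hv.1] using hv.2
    rw [norm_mul, norm_pow, norm_pow]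
    exact mul_le_of_le_one_right (by positivity) (pow_le_one₀ (norm_nonneg _) h1)
  have hint : ∀ n : ℕ, Integrable (fun v : ℝ => z ^ n * (v : ℂ) ^ (n + 1)) (timeMeasure k) :=
    fun n => integrable_timeMeasure_of_norm_le (hmeas n).aestronglyMeasurable _ (hbound n)
  have hsum : Summable fun n : ℕ => ∫ v : ℝ, ‖z ^ n * (v : ℂ) ^ (n + 1)‖ ∂timeMeasure k := by
    refine Summable.of_nonneg_of_le (fun n => integral_nonneg fun _ => norm_nonneg _) (fun n => ?_)
      ((summable_geometric_of_lt_one (norm_nonneg z) hz).mul_right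
        ((timeMeasure k).real Set.univ))
    refine (integral_mono_ae (hint n).norm (integrable_const (‖z‖ ^ n))
      ((ae_mem_Ioc_timeMeasure k).mono (hbound n))).trans_eq ?_
    simp [mul_comm]
  have key := hasSum_integral_of_summable_integral_norm hint hsum
  have hfun : (fun n : ℕ => z ^ n / ((2 : ℂ) + n) ^ (k : ℂ))
      = fun n : ℕ => ∫ v : ℝ, z ^ n * (v : ℂ) ^ (n + 1) ∂timeMeasure k := by
    funext n
    rw [integral_const_mul, integral_ofReal_pow_timeMeasure hk, Complex.cpow_natCast]
    push_cast
    rw [mul_one_div]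
    congr 2
    ring
  have hval : lerchIntegral k z
      = ∫ v : ℝ, ∑' n : ℕ, z ^ n * (v : ℂ) ^ (n + 1) ∂timeMeasure k := by
    refine integral_congr_ae ?_
    filter_upwards [ae_mem_Ioc_timeMeasure k] with v hv
    have h1 : ‖(v : ℂ)‖ ≤ 1 := by simpa [abs_of_pos hv.1] using hv.2
    have h2 : ‖z * v‖ < 1 := by
      rw [norm_mul]
      exact lt_of_le_of_lt (mul_le_of_le_one_right (norm_nonneg _) h1) hz
    have h3 := (hasSum_geometric_of_norm_lt_one h2).mul_left (v : ℂ)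
    rw [div_eq_mul_inv, ← h3.tsum_eq]
    congr 1
    funext n
    rw [mul_pow]
    ring
  rw [hfun, hval]
  exact key

lemma isHurwitzLerch_lerchIntegral {k : ℕ} (hk : 1 ≤ k) :
    IsHurwitzLerch k 2 (lerchIntegral k) :=
  ⟨differentiableOn_lerchIntegral k, fun _ hz => hasSum_lerchIntegral hk hz⟩

/-- Identity theorem on the connected cut plane. `hurwitzLerch` is defined by choice, so this
uniqueness is what makes its values off the cut computable. -/
lemma IsHurwitzLerch.eqOn {s v : ℂ} {f g : ℂ → ℂ} (hf : IsHurwitzLerch s v f)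
    (hg : IsHurwitzLerch s v g) : Set.EqOn f g {z : ℂ | ¬ (1 ≤ z.re ∧ z.im = 0)} := by
  refine (hf.1.analyticOnNhd isOpen_cutPlane).eqOn_of_preconnected_of_eventuallyEq
    (hg.1.analyticOnNhd isOpen_cutPlane) isPreconnected_cutPlane (z₀ := 0) (by simp) ?_
  filter_upwards [Metric.ball_mem_nhds (0 : ℂ) one_pos] with z hz
  have hz' : ‖z‖ < 1 := by simpa using hz
  exact (hf.2 z hz').unique (hg.2 z hz')

lemma hurwitzLerch_eq_lerchIntegral {k : ℕ} (hk : 1 ≤ k) {z : ℂ}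
    (hz : ¬ (1 ≤ z.re ∧ z.im = 0)) : hurwitzLerch z k 2 = lerchIntegral k z := by
  have hex : ∃ f : ℂ → ℂ, IsHurwitzLerch k 2 f := ⟨_, isHurwitzLerch_lerchIntegral hk⟩
  rw [hurwitzLerch, dif_pos hex]
  exact hex.choose_spec.eqOn (isHurwitzLerch_lerchIntegral hk) hz

/-! ### The integral representation of the kernel in Khintchine's form -/

/-- The kernel in Khintchine's form before integration over the time change. -/
noncomputable def dilationKernel (t v x : ℝ) : ℂ :=
  (v : ℂ) * (x - Complex.I * v / t) / (1 + Complex.I * v * x / t)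

lemma dilationKernel_denom_ne_zero (t v x : ℝ) : 1 + Complex.I * v * x / t ≠ 0 := by
  intro h
  have h' : (1 : ℂ) + ((v * x / t : ℝ) : ℂ) * Complex.I = 0 := by
    rw [← h]; push_cast; ring
  simpa using congrArg Complex.re h'

lemma measurable_dilationKernel (t : ℝ) :
    Measurable (fun p : ℝ × ℝ => dilationKernel t p.1 p.2) := by
  unfold dilationKernel
  fun_prop

lemma continuous_dilationKernel (t v : ℝ) : Continuous (fun x : ℝ => dilationKernel t v x) := by
  unfold dilationKernel
  exact Continuous.div (by fun_prop) (by fun_prop) (dilationKernel_denom_ne_zero t v)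

/-- The denominator 1 + ivx/t has modulus at least 1 (real part) and at least |vx|/t (imaginary
part). The first absorbs the term v²/t of the numerator, the second the term vx. Uniformity in x is
what makes (2) converge for every finite m. -/
lemma norm_dilationKernel_le {t : ℝ} (ht : 0 < t) {v : ℝ} (hv : v ∈ Set.Ioc (0 : ℝ) 1) (x : ℝ) :
    ‖dilationKernel t v x‖ ≤ t + 1 / t := by
  have hden : (1 : ℂ) + Complex.I * v * x / t = ((1 : ℝ) : ℂ) + ((v * x / t : ℝ) : ℂ) * Complex.I := by
    push_cast; ring
  have hre : 1 ≤ ‖1 + Complex.I * v * x / t‖ := by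
    rw [hden]
    refine le_trans ?_ (Complex.abs_re_le_norm _)
    simp
  have him : |v * x| ≤ t * ‖1 + Complex.I * v * x / t‖ := by
    rw [hden]
    have := Complex.abs_im_le_norm (((1 : ℝ) : ℂ) + ((v * x / t : ℝ) : ℂ) * Complex.I)
    simp only [Complex.add_im, Complex.ofReal_im, Complex.mul_im, Complex.ofReal_re, Complex.I_im,
      Complex.I_re, mul_one, mul_zero, zero_add, add_zero] at this
    rw [abs_div, abs_of_pos ht, div_le_iff₀ ht] at this
    linarith
  rw [dilationKernel, norm_div, div_le_iff₀ (by linarith)]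
  have hnum : ‖(v : ℂ) * (x - Complex.I * v / t)‖ ≤ |v * x| + 1 / t := by
    have : (v : ℂ) * (x - Complex.I * v / t)
        = ((v * x : ℝ) : ℂ) - Complex.I * ((v ^ 2 / t : ℝ) : ℂ) := by push_cast; ring
    rw [this]
    refine (norm_sub_le _ _).trans ?_
    rw [norm_mul, Complex.norm_I, one_mul, Complex.norm_real, Complex.norm_real,
      Real.norm_eq_abs, Real.norm_eq_abs, abs_of_nonneg (by positivity : 0 ≤ v ^ 2 / t)]
    have : v ^ 2 ≤ 1 := pow_le_one₀ hv.1.le hv.2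
    gcongr
  have : 1 / t ≤ 1 / t * ‖1 + Complex.I * v * x / t‖ := le_mul_of_one_le_right (by positivity) hre
  linarith

lemma integrable_dilationKernel (k : ℕ) {t : ℝ} (ht : 0 < t) (x : ℝ) :
    Integrable (fun v => dilationKernel t v x) (timeMeasure k) :=
  integrable_timeMeasure_of_norm_le
    ((measurable_dilationKernel t).comp (measurable_id.prodMk measurable_const)).aestronglyMeasurable
    _ fun _ hv => norm_dilationKernel_le ht hv x

/-- At x = 0 this is the second moment of dτ_k. Otherwise, v / (1 - zv) with z = x/(it) splits as
x/(1 + x²) times the dilation kernel plus v/(1 + x²), and the last term integrates to the centering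
2^(-k)/(1 + x²). -/
lemma khintchineKernel_eq_integral {k : ℕ} (hk : 1 ≤ k) {t : ℝ} (ht : 0 < t) (x : ℝ) :
    khintchineKernel k t x = ∫ v, dilationKernel t v x ∂timeMeasure k := by
  have htc : (t : ℂ) ≠ 0 := by exact_mod_cast ht.ne'
  by_cases hx : x = 0
  · subst hx
    have h2 := integral_ofReal_pow_timeMeasure hk 2
    have : ∀ v : ℝ, dilationKernel t v 0 = (v : ℂ) ^ 2 * (1 / (Complex.I * t)) := fun v => by
      simp only [dilationKernel, Complex.ofReal_zero, mul_zero, zero_div, add_zero, div_one]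
      field_simp
      linear_combination (-(v : ℂ) ^ 2) * Complex.I_sq
    simp_rw [this]
    rw [integral_mul_const, h2, khintchineKernel, if_pos rfl]
    push_cast
    norm_num
    field_simp
  · have hxc : (x : ℂ) ≠ 0 := by exact_mod_cast hx
    -- The argument x/(it) is purely imaginary, hence off the cut.
    have hz : ¬ (1 ≤ ((x : ℂ) / (Complex.I * t)).re ∧ ((x : ℂ) / (Complex.I * t)).im = 0) := by
      have : (x : ℂ) / (Complex.I * t) = ((-(x / t) : ℝ) : ℂ) * Complex.I := by
        push_cast
        field_simp
        rw [Complex.I_sq]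
        ring
      rw [this]
      simp
    have h1 := integral_ofReal_pow_timeMeasure hk 1
    have hx2 : (1 : ℂ) + (x : ℂ) ^ 2 ≠ 0 := by
      have : (0 : ℝ) < 1 + x ^ 2 := by positivity
      exact_mod_cast this.ne'
    have hpt : ∀ v : ℝ, (v : ℂ) / (1 - (x : ℂ) / (Complex.I * t) * v)
        = dilationKernel t v x * (x / (1 + (x : ℂ) ^ 2)) + (v : ℂ) ^ 1 / (1 + (x : ℂ) ^ 2) := by
      intro v
      have hd := dilationKernel_denom_ne_zero t v x
      have hd' : 1 - (x : ℂ) / (Complex.I * t) * v = 1 + Complex.I * v * x / t := by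
        field_simp
        linear_combination (-(x * v : ℂ)) * Complex.I_sq
      have hs : Complex.I * v * x / t = Complex.I * v / t * x := by ring
      rw [hd', dilationKernel]
      rw [hs] at hd ⊢
      -- With s = iv/t as an indeterminate the identity is rational in s, v and x, and I² = -1 plays
      -- no role.
      generalize Complex.I * v / t = s at *
      field_simp
      ring
    have hI : hurwitzLerch ((x : ℂ) / (Complex.I * t)) k 2
        = (∫ v, dilationKernel t v x ∂timeMeasure k) * (x / (1 + (x : ℂ) ^ 2))
          + 1 / 2 ^ k / (1 + (x : ℂ) ^ 2) := by
      rw [hurwitzLerch_eq_lerchIntegral hk hz, lerchIntegral]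
      simp_rw [hpt]
      rw [integral_add ((integrable_dilationKernel k ht x).mul_const _), integral_mul_const,
        integral_div, h1]
      · norm_num
      · refine integrable_timeMeasure_of_norm_le (Measurable.aestronglyMeasurable (by fun_prop))
          (1 / ‖1 + (x : ℂ) ^ 2‖) fun v hv => ?_
        rw [norm_div, pow_one]
        have h1 : ‖(v : ℂ)‖ ≤ 1 := by simpa [abs_of_pos hv.1] using hv.2
        gcongr
    rw [khintchineKernel, if_neg hx, bracket, hI]
    field_simp
    ring

lemma norm_khintchineKernel_le {k : ℕ} (hk : 1 ≤ k) {t : ℝ} (ht : 0 < t) (x : ℝ) :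
    ‖khintchineKernel k t x‖ ≤ (t + 1 / t) * (timeMeasure k).real Set.univ := by
  rw [khintchineKernel_eq_integral hk ht]
  exact norm_integral_le_of_norm_le_const
    ((ae_mem_Ioc_timeMeasure k).mono fun v hv => norm_dilationKernel_le ht hv x)

lemma continuous_khintchineKernel {k : ℕ} (hk : 1 ≤ k) {t : ℝ} (ht : 0 < t) :
    Continuous (khintchineKernel k t) := by
  have : khintchineKernel k t = fun x => ∫ v, dilationKernel t v x ∂timeMeasure k :=
    funext (khintchineKernel_eq_integral hk ht)
  rw [this]
  refine continuous_of_dominated (bound := fun _ => t + 1 / t)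
    (fun x => (integrable_dilationKernel k ht x).aestronglyMeasurable)
    (fun x => (ae_mem_Ioc_timeMeasure k).mono fun v hv => norm_dilationKernel_le ht hv x)
    (integrable_const _) (Eventually.of_forall fun v => continuous_dilationKernel t v)

lemma integrable_khintchineKernel {k : ℕ} (hk : 1 ≤ k) {t : ℝ} (ht : 0 < t) (m : Measure ℝ)
    [IsFiniteMeasure m] : Integrable (khintchineKernel k t) m :=
  Integrable.of_bound (continuous_khintchineKernel hk ht).aestronglyMeasurable _
    (Eventually.of_forall (norm_khintchineKernel_le hk ht))

/-- The integral representation makes the kernel continuous on all of ℝ, so the value prescribed at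
0 is the limit there. -/
lemma tendsto_bracket_mul {k : ℕ} (hk : 1 ≤ k) {t : ℝ} (ht : 0 < t) :
    Tendsto (fun x : ℝ => bracket k t x * ((1 + (x : ℂ) ^ 2) / x)) (𝓝[≠] 0)
      (𝓝 (1 / (3 ^ k * (Complex.I * t)))) := by
  have h := ((continuous_khintchineKernel hk ht).tendsto 0).mono_left
    (nhdsWithin_le_nhds (s := {0}ᶜ))
  rw [khintchineKernel, if_pos rfl] at h
  refine h.congr' ?_
  filter_upwards [self_mem_nhdsWithin] with x hx
  rw [khintchineKernel, if_neg (by simpa using hx)]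

/-! ### The kernel of the Lévy–Khintchine formula in Khintchine's form -/

/-- The kernel `(e^{iyx} - 1 - iyx / (1 + x²)) (1 + x²) / x²`, with the value `-y² / 2` at `0`. -/
noncomputable def levyKernel (y x : ℝ) : ℂ :=
  if x = 0 then -(y : ℂ) ^ 2 / 2 else
    (Complex.exp (Complex.I * y * x) - 1 - Complex.I * y * x / (1 + (x : ℂ) ^ 2))
      * ((1 + (x : ℂ) ^ 2) / (x : ℂ) ^ 2)

lemma norm_exp_I_mul_mul (y x : ℝ) : ‖Complex.exp (Complex.I * y * x)‖ = 1 := by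
  have : Complex.I * y * x = ((y * x : ℝ) : ℂ) * Complex.I := by push_cast; ring
  rw [this, Complex.norm_exp_ofReal_mul_I]

lemma norm_I_mul_mul (y x : ℝ) : ‖Complex.I * y * x‖ = |y| * |x| := by simp

lemma one_add_sq_ne_zero (x : ℝ) : (1 : ℂ) + (x : ℂ) ^ 2 ≠ 0 := by
  have : (0 : ℝ) < 1 + x ^ 2 := by positivity
  exact_mod_cast this.ne'

lemma norm_one_add_sq_div (x : ℝ) :
    ‖(1 + (x : ℂ) ^ 2) / (x : ℂ) ^ 2‖ = (1 + x ^ 2) / x ^ 2 := by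
  have : (1 + (x : ℂ) ^ 2) / (x : ℂ) ^ 2 = (((1 + x ^ 2) / x ^ 2 : ℝ) : ℂ) := by push_cast; ring
  rw [this, Complex.norm_real, Real.norm_of_nonneg (by positivity)]

lemma norm_exp_sub_one_sub_le (y x : ℝ) :
    ‖Complex.exp (Complex.I * y * x) - 1 - Complex.I * y * x‖ ≤ 3 * (|y| * |x|) ^ 2 := by
  have hn := norm_I_mul_mul y x
  rcases le_total (|y| * |x|) 1 with h | h
  · have := Complex.norm_exp_sub_one_sub_id_le (hn.le.trans h)
    rw [hn] at this
    nlinarith [sq_nonneg (|y| * |x|)]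
  · have h1 : ‖Complex.exp (Complex.I * y * x) - 1 - Complex.I * y * x‖ ≤ 1 + 1 + |y| * |x| := by
      refine (norm_sub_le _ _).trans (add_le_add ((norm_sub_le _ _).trans ?_) hn.le)
      rw [norm_exp_I_mul_mul, norm_one]
    nlinarith

/-- Boundedness in x allows integration against any finite m; quadratic growth in y is harmless
under e^(-tu). For |x| ≤ 1, replacing the centering iyx/(1 + x²) by iyx costs exactly iyx after
division by x²/(1 + x²), and the rest is a second order Taylor remainder. For |x| ≥ 1 the factor (1
+ x²)/x² is at most 2. -/
lemma norm_levyKernel_le (y x : ℝ) : ‖levyKernel y x‖ ≤ 7 * (1 + y ^ 2) := by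
  have hy : |y| ≤ 1 + y ^ 2 := by
    rw [← sq_abs y]
    nlinarith [sq_nonneg (|y| - 1), abs_nonneg y]
  by_cases hx : x = 0
  · rw [levyKernel, if_pos hx, norm_div, norm_neg, norm_pow, Complex.norm_real, Real.norm_eq_abs,
      sq_abs, Complex.norm_ofNat]
    nlinarith [sq_nonneg y]
  have hxc : (x : ℂ) ≠ 0 := by exact_mod_cast hx
  have hx2 : 0 < x ^ 2 := by positivity
  have hne := one_add_sq_ne_zero x
  rw [levyKernel, if_neg hx]
  rcases le_total |x| 1 with h | h
  · have hsq : x ^ 2 ≤ 1 := by rw [← sq_abs]; exact pow_le_one₀ (abs_nonneg x) h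
    have : (Complex.exp (Complex.I * y * x) - 1 - Complex.I * y * x / (1 + (x : ℂ) ^ 2))
          * ((1 + (x : ℂ) ^ 2) / (x : ℂ) ^ 2)
        = (Complex.exp (Complex.I * y * x) - 1 - Complex.I * y * x)
          * ((1 + (x : ℂ) ^ 2) / (x : ℂ) ^ 2) + Complex.I * y * x := by
      field_simp
      ring
    rw [this]
    refine (norm_add_le _ _).trans ?_
    rw [norm_mul, norm_one_add_sq_div, norm_I_mul_mul]
    have h1 : ‖Complex.exp (Complex.I * y * x) - 1 - Complex.I * y * x‖ * ((1 + x ^ 2) / x ^ 2)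
        ≤ 3 * (|y| * |x|) ^ 2 * ((1 + x ^ 2) / x ^ 2) := by
      gcongr
      exact norm_exp_sub_one_sub_le y x
    have h2 : 3 * (|y| * |x|) ^ 2 * ((1 + x ^ 2) / x ^ 2) = 3 * y ^ 2 * (1 + x ^ 2) := by
      rw [mul_pow, sq_abs, sq_abs]
      field_simp
    have h3 : |y| * |x| ≤ |y| := mul_le_of_le_one_right (abs_nonneg y) h
    nlinarith [mul_nonneg (sq_nonneg y) (sub_nonneg.2 hsq)]
  · have hsq : 1 ≤ x ^ 2 := by rw [← sq_abs]; exact one_le_pow₀ h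
    have : (Complex.exp (Complex.I * y * x) - 1 - Complex.I * y * x / (1 + (x : ℂ) ^ 2))
          * ((1 + (x : ℂ) ^ 2) / (x : ℂ) ^ 2)
        = (Complex.exp (Complex.I * y * x) - 1)
          * ((1 + (x : ℂ) ^ 2) / (x : ℂ) ^ 2) - Complex.I * y * x / (x : ℂ) ^ 2 := by
      field_simp
    rw [this]
    refine (norm_sub_le _ _).trans ?_
    rw [norm_mul, norm_one_add_sq_div, norm_div, norm_I_mul_mul, norm_pow, Complex.norm_real,
      Real.norm_eq_abs]
    have h1 : ‖Complex.exp (Complex.I * y * x) - 1‖ ≤ 2 := by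
      refine (norm_sub_le _ _).trans ?_
      rw [norm_exp_I_mul_mul, norm_one]
      norm_num
    have h2 : (1 + x ^ 2) / x ^ 2 ≤ 2 := by
      rw [div_le_iff₀ hx2]
      linarith
    have h3 : |y| * |x| / |x| ^ 2 ≤ |y| := by
      rw [div_le_iff₀ (by positivity), sq]
      exact mul_le_mul_of_nonneg_left (le_mul_of_one_le_left (abs_nonneg x) h) (abs_nonneg y)
    have h4 : ‖Complex.exp (Complex.I * y * x) - 1‖ * ((1 + x ^ 2) / x ^ 2) ≤ 2 * 2 := by
      gcongr
    nlinarith [sq_nonneg y]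

lemma measurable_levyKernel : Measurable (fun p : ℝ × ℝ => levyKernel p.1 p.2) := by
  unfold levyKernel
  refine Measurable.ite (measurable_snd (measurableSet_singleton 0)) ?_ ?_ <;> fun_prop

lemma continuous_levyKernel_left (x : ℝ) : Continuous (fun y : ℝ => levyKernel y x) := by
  unfold levyKernel
  by_cases hx : x = 0
  · simp only [hx, if_true]
    fun_prop
  · simp only [hx, if_false]
    fun_prop

/-- The Taylor remainder of order three is O(|yx|³), so dividing by x² leaves O(|x|); the remaining
corrections are iyx and -y²x²/2. Continuity at 0 makes the kernel a valid test function for weak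
convergence, even when mass accumulates at 0. -/
lemma continuousAt_levyKernel_zero (y : ℝ) : ContinuousAt (levyKernel y) 0 := by
  rw [ContinuousAt, tendsto_iff_norm_sub_tendsto_zero]
  have hlim : Tendsto (fun x : ℝ => (2 * |y| ^ 3 + y ^ 2 + |y|) * |x|) (𝓝 0) (𝓝 0) := by
    have : Continuous (fun x : ℝ => (2 * |y| ^ 3 + y ^ 2 + |y|) * |x|) := by fun_prop
    simpa using this.tendsto 0
  refine squeeze_zero' (Eventually.of_forall fun _ => norm_nonneg _) ?_ hlim
  have hsmall : ∀ᶠ x : ℝ in 𝓝 0, |y| * |x| < 1 := by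
    have : Continuous (fun x : ℝ => |y| * |x|) := by fun_prop
    exact (this.tendsto 0).eventually_lt_const (by simp)
  have hone : ∀ᶠ x : ℝ in 𝓝 0, |x| < 1 :=
    (continuous_abs.tendsto 0).eventually_lt_const (by simp)
  filter_upwards [hsmall, hone] with x hyx hx1
  by_cases hx : x = 0
  · simp [hx]
  have hxc : (x : ℂ) ≠ 0 := by exact_mod_cast hx
  have hx2 : 0 < x ^ 2 := by positivity
  have hne := one_add_sq_ne_zero x
  rw [levyKernel, levyKernel, if_neg hx, if_pos rfl]
  have hsq : x ^ 2 ≤ |x| := by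
    rw [← sq_abs, sq]
    exact mul_le_of_le_one_right (abs_nonneg x) hx1.le
  have hid : (Complex.exp (Complex.I * y * x) - 1 - Complex.I * y * x / (1 + (x : ℂ) ^ 2))
        * ((1 + (x : ℂ) ^ 2) / (x : ℂ) ^ 2) - -(y : ℂ) ^ 2 / 2
      = (Complex.exp (Complex.I * y * x)
          - ∑ j ∈ Finset.range 3, (Complex.I * y * x) ^ j / (j.factorial : ℂ))
          * ((1 + (x : ℂ) ^ 2) / (x : ℂ) ^ 2)
        + (((-(y ^ 2 * x ^ 2 / 2) : ℝ) : ℂ) + Complex.I * y * x) := by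
    simp only [Finset.sum_range_succ, Finset.sum_range_zero, Nat.factorial]
    push_cast
    field_simp
    linear_combination ((y : ℂ) ^ 2 * x ^ 2 + (y : ℂ) ^ 2 * x ^ 4) * Complex.I_sq
  rw [hid]
  have h3 : ‖Complex.exp (Complex.I * y * x)
      - ∑ j ∈ Finset.range 3, (Complex.I * y * x) ^ j / (j.factorial : ℂ)‖
      ≤ (|y| * |x|) ^ 3 := by
    have := Complex.exp_bound ((norm_I_mul_mul y x).le.trans hyx.le) (n := 3) (by norm_num)
    rw [norm_I_mul_mul] at this
    refine this.trans (mul_le_of_le_one_right (by positivity) ?_)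
    norm_num [Nat.factorial]
  have h4 : ‖(Complex.exp (Complex.I * y * x)
      - ∑ j ∈ Finset.range 3, (Complex.I * y * x) ^ j / (j.factorial : ℂ))
        * ((1 + (x : ℂ) ^ 2) / (x : ℂ) ^ 2)‖ ≤ 2 * |y| ^ 3 * |x| := by
    rw [norm_mul, norm_one_add_sq_div]
    calc _ ≤ (|y| * |x|) ^ 3 * ((1 + x ^ 2) / x ^ 2) := by gcongr
      _ = |y| ^ 3 * |x| * (1 + x ^ 2) := by
        rw [← sq_abs x]
        have : |x| ≠ 0 := abs_ne_zero.2 hx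
        field_simp
      _ ≤ |y| ^ 3 * |x| * 2 := by
        gcongr
        linarith
      _ = _ := by ring
  have h5 : ‖(((-(y ^ 2 * x ^ 2 / 2) : ℝ) : ℂ) + Complex.I * y * x)‖ ≤ y ^ 2 * |x| + |y| * |x| := by
    refine (norm_add_le _ _).trans ?_
    rw [norm_I_mul_mul, Complex.norm_real, norm_neg, Real.norm_of_nonneg (by positivity)]
    nlinarith [mul_nonneg (sq_nonneg y) (sub_nonneg.2 hsq), mul_nonneg (sq_nonneg y) (sq_nonneg x)]
  refine (norm_add_le _ _).trans ?_
  linarith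

lemma continuous_levyKernel (y : ℝ) : Continuous (levyKernel y) := by
  rw [continuous_iff_continuousAt]
  intro x
  by_cases hx : x = 0
  · subst hx
    exact continuousAt_levyKernel_zero y
  have hxc : (x : ℂ) ≠ 0 := by exact_mod_cast hx
  have hc : ContinuousAt (fun x : ℝ => (Complex.exp (Complex.I * y * x) - 1
      - Complex.I * y * x / (1 + (x : ℂ) ^ 2)) * ((1 + (x : ℂ) ^ 2) / (x : ℂ) ^ 2)) x := by
    have h1 : ContinuousAt (fun x : ℝ => Complex.I * y * x / (1 + (x : ℂ) ^ 2)) x :=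
      ContinuousAt.div (by fun_prop) (by fun_prop) (one_add_sq_ne_zero x)
    have h2 : ContinuousAt (fun x : ℝ => (1 + (x : ℂ) ^ 2) / (x : ℂ) ^ 2) x :=
      ContinuousAt.div (by fun_prop) (by fun_prop) (pow_ne_zero 2 hxc)
    exact (ContinuousAt.sub (by fun_prop) h1).mul h2
  refine hc.congr ?_
  filter_upwards [isOpen_ne.mem_nhds hx] with z hz
  rw [levyKernel, if_neg hz]

lemma integrable_levyKernel (m : Measure ℝ) [IsFiniteMeasure m] (y : ℝ) :
    Integrable (levyKernel y) m :=
  Integrable.of_bound (continuous_levyKernel y).aestronglyMeasurable _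
    (Eventually.of_forall (norm_levyKernel_le y))

lemma levyKernel_zero_left (x : ℝ) : levyKernel 0 x = 0 := by simp [levyKernel]

/-! ### The exponent of the Lévy–Khintchine formula -/

/-- The exponent `iya + ∫ (e^{iyx} - 1 - iyx / (1 + x²)) (1 + x²) / x² m(dx)`. -/
noncomputable def levyExponent (a : ℝ) (m : Measure ℝ) (y : ℝ) : ℂ :=
  Complex.I * y * a + ∫ x, levyKernel y x ∂m

lemma levyExponent_zero (a : ℝ) (m : Measure ℝ) : levyExponent a m 0 = 0 := by
  simp [levyExponent, levyKernel_zero_left]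

lemma norm_integral_levyKernel_le (m : Measure ℝ) [IsFiniteMeasure m] (y : ℝ) :
    ‖∫ x, levyKernel y x ∂m‖ ≤ 7 * (1 + y ^ 2) * m.real Set.univ :=
  norm_integral_le_of_norm_le_const (Eventually.of_forall (norm_levyKernel_le y))

lemma continuous_integral_levyKernel (m : Measure ℝ) [IsFiniteMeasure m] :
    Continuous (fun y => ∫ x, levyKernel y x ∂m) := by
  rw [continuous_iff_continuousAt]
  intro y₀
  refine continuousAt_of_dominated (bound := fun _ => 7 * (1 + (|y₀| + 1) ^ 2))
    (Eventually.of_forall fun y => (continuous_levyKernel y).aestronglyMeasurable) ?_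
    (integrable_const _)
    (Eventually.of_forall fun x => (continuous_levyKernel_left x).continuousAt)
  have : ∀ᶠ y : ℝ in 𝓝 y₀, |y| < |y₀| + 1 :=
    (continuous_abs.tendsto y₀).eventually_lt_const (by linarith)
  filter_upwards [this] with y hy
  refine Eventually.of_forall fun x => (norm_levyKernel_le y x).trans ?_
  rw [← sq_abs y]
  gcongr

lemma continuous_levyExponent (a : ℝ) (m : Measure ℝ) [IsFiniteMeasure m] :
    Continuous (levyExponent a m) := by
  unfold levyExponent
  have := continuous_integral_levyKernel m
  fun_prop

lemma norm_levyExponent_le (a : ℝ) (m : Measure ℝ) [IsFiniteMeasure m] (y : ℝ) :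
    ‖levyExponent a m y‖ ≤ (|a| + 7 * m.real Set.univ) * (1 + y ^ 2) := by
  refine (norm_add_le _ _).trans ?_
  have h1 := norm_integral_levyKernel_le m y
  rw [norm_I_mul_mul]
  have hy : |y| ≤ 1 + y ^ 2 := by
    rw [← sq_abs y]
    nlinarith [sq_nonneg (|y| - 1), abs_nonneg y]
  nlinarith [abs_nonneg a]

lemma levyExponent_smul (a : ℝ) (m : Measure ℝ) (s : ℝ≥0) (y : ℝ) :
    levyExponent (s * a) (s • m) y = s * levyExponent a m y := by
  rw [levyExponent, levyExponent, integral_smul_nnreal_measure, NNReal.smul_def,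
    Complex.real_smul]
  push_cast
  ring

/-! ### Lévy measures and finite measures -/

lemma measurable_ofReal_sq_div : Measurable fun x : ℝ => ENNReal.ofReal (x ^ 2 / (1 + x ^ 2)) := by
  fun_prop

lemma isFiniteMeasure_khintchineMeasure (σsq : ℝ≥0) {M : Measure ℝ} (hM : IsLevyMeasure M) :
    IsFiniteMeasure (khintchineMeasure σsq M) := by
  have : IsFiniteMeasure (M.withDensity fun x => ENNReal.ofReal (x ^ 2 / (1 + x ^ 2))) := by
    refine isFiniteMeasure_withDensity (lt_of_le_of_lt (lintegral_mono fun x => ?_) hM.2).ne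
    refine ENNReal.ofReal_le_ofReal (le_min ?_ ?_)
    · rw [div_le_one (by positivity)]
      linarith [sq_nonneg x]
    · exact div_le_self (sq_nonneg x) (by linarith [sq_nonneg x])
  unfold khintchineMeasure
  infer_instance

lemma integrable_withDensity_iff_mul {M : Measure ℝ} {f : ℝ → ℂ} :
    Integrable f (M.withDensity fun x => ENNReal.ofReal (x ^ 2 / (1 + x ^ 2))) ↔
      Integrable (fun x : ℝ => ((x ^ 2 / (1 + x ^ 2) : ℝ) : ℂ) * f x) M := by
  rw [integrable_withDensity_iff_integrable_smul' measurable_ofReal_sq_div (by simp)]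
  refine integrable_congr (Eventually.of_forall fun x => ?_)
  simp only [ENNReal.toReal_ofReal (by positivity : 0 ≤ x ^ 2 / (1 + x ^ 2)), Complex.real_smul]

lemma integrable_mul_of_integrable_khintchineMeasure {σsq : ℝ≥0} {M : Measure ℝ} {f : ℝ → ℂ}
    (hf : Integrable f (khintchineMeasure σsq M)) :
    Integrable (fun x : ℝ => ((x ^ 2 / (1 + x ^ 2) : ℝ) : ℂ) * f x) M :=
  integrable_withDensity_iff_mul.1 (hf.mono_measure (Measure.le_add_right le_rfl))

lemma integral_khintchineMeasure {σsq : ℝ≥0} {M : Measure ℝ} {f : ℝ → ℂ}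
    (hf : Integrable f (khintchineMeasure σsq M)) :
    ∫ x, f x ∂khintchineMeasure σsq M
      = ∫ x, ((x ^ 2 / (1 + x ^ 2) : ℝ) : ℂ) * f x ∂M + (σsq : ℝ) * f 0 := by
  have h1 : Integrable f (M.withDensity fun x => ENNReal.ofReal (x ^ 2 / (1 + x ^ 2))) :=
    hf.mono_measure (Measure.le_add_right le_rfl)
  have h2 : Integrable f (σsq • Measure.dirac 0) :=
    hf.mono_measure (Measure.le_add_left le_rfl)
  rw [khintchineMeasure, integral_add_measure h1 h2, integral_smul_nnreal_measure, integral_dirac,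
    integral_withDensity_eq_integral_toReal_smul measurable_ofReal_sq_div (by simp),
    NNReal.smul_def, Complex.real_smul]
  congr 1
  refine integral_congr_ae (Eventually.of_forall fun x => ?_)
  simp only [ENNReal.toReal_ofReal (by positivity : 0 ≤ x ^ 2 / (1 + x ^ 2)), Complex.real_smul]

/-- The atom at 0 becomes σ²; off 0 the density x²/(1 + x²) is inverted. The Lévy condition follows
from min(1, x²)(1 + x²)/x² ≤ 2. -/
lemma exists_khintchineMeasure_eq (m : Measure ℝ) [IsFiniteMeasure m] :
    ∃ (σsq : ℝ≥0) (M : Measure ℝ), IsLevyMeasure M ∧ khintchineMeasure σsq M = m := by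
  set r : ℝ → ENNReal := fun x => ENNReal.ofReal ((1 + x ^ 2) / x ^ 2) with hr
  have hrm : Measurable r := by fun_prop
  refine ⟨(m {0}).toNNReal, (m.restrict {0}ᶜ).withDensity r, ⟨?_, ?_⟩, ?_⟩
  · refine (withDensity_absolutelyContinuous _ _) ?_
    simp
  · rw [lintegral_withDensity_eq_lintegral_mul _ hrm (by fun_prop)]
    refine lt_of_le_of_lt (lintegral_mono (g := fun _ => 2) fun x => ?_) ?_
    · simp only [Pi.mul_apply, hr]
      rw [← ENNReal.ofReal_mul (by positivity), ← ENNReal.ofReal_ofNat 2]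
      refine ENNReal.ofReal_le_ofReal ?_
      by_cases hx : x = 0
      · simp [hx]
      have hx2 : 0 < x ^ 2 := by positivity
      rw [div_mul_eq_mul_div, div_le_iff₀ hx2]
      rcases le_total 1 (x ^ 2) with h | h
      · rw [min_eq_left h]; linarith
      · rw [min_eq_right h]; nlinarith
    · rw [lintegral_const]
      exact ENNReal.mul_lt_top (by simp) (measure_lt_top _ _)
  · have h1 : ((m.restrict {0}ᶜ).withDensity r).withDensity
        (fun x => ENNReal.ofReal (x ^ 2 / (1 + x ^ 2))) = m.restrict {0}ᶜ := by
      rw [← withDensity_mul _ hrm measurable_ofReal_sq_div]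
      have : (r * fun x => ENNReal.ofReal (x ^ 2 / (1 + x ^ 2))) =ᵐ[m.restrict {0}ᶜ] 1 := by
        filter_upwards [ae_restrict_mem (measurableSet_singleton (0 : ℝ)).compl] with x hx
        have hx0 : x ≠ 0 := by simpa using hx
        simp only [Pi.mul_apply, hr, Pi.one_apply]
        rw [← ENNReal.ofReal_mul (by positivity)]
        have : (1 + x ^ 2) / x ^ 2 * (x ^ 2 / (1 + x ^ 2)) = 1 := by field_simp
        rw [this, ENNReal.ofReal_one]
      rw [withDensity_congr_ae this, withDensity_one]
    have h2 : ((m {0}).toNNReal) • Measure.dirac (0 : ℝ) = m.restrict {0} := by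
      rw [Measure.restrict_singleton]
      ext s _
      simp [ENNReal.smul_def, ENNReal.coe_toNNReal (measure_ne_top m {0})]
    rw [khintchineMeasure, h1, h2, Measure.restrict_compl_add_restrict (measurableSet_singleton 0)]

lemma ofReal_mul_levyKernel (y x : ℝ) :
    ((x ^ 2 / (1 + x ^ 2) : ℝ) : ℂ) * levyKernel y x
      = Complex.exp (Complex.I * y * x) - 1 - Complex.I * y * x / (1 + (x : ℂ) ^ 2) := by
  by_cases hx : x = 0
  · simp [hx]
  have hxc : (x : ℂ) ≠ 0 := by exact_mod_cast hx
  have := one_add_sq_ne_zero x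
  rw [levyKernel, if_neg hx]
  push_cast
  field_simp

lemma ofReal_mul_khintchineKernel (k : ℕ) (t x : ℝ) :
    ((x ^ 2 / (1 + x ^ 2) : ℝ) : ℂ) * khintchineKernel k t x = x * bracket k t x := by
  by_cases hx : x = 0
  · simp [hx]
  have hxc : (x : ℂ) ≠ 0 := by exact_mod_cast hx
  have := one_add_sq_ne_zero x
  rw [khintchineKernel, if_neg hx]
  push_cast
  field_simp

lemma levyExponent_khintchineMeasure (a : ℝ) (σsq : ℝ≥0) {M : Measure ℝ} (hM : IsLevyMeasure M)
    (t : ℝ) :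
    levyExponent a (khintchineMeasure σsq M) t
      = Complex.I * t * a - (1 / 2 : ℂ) * ((σsq : ℝ) : ℂ) * (t : ℂ) ^ 2
        + ∫ x : ℝ, (Complex.exp (Complex.I * t * x) - 1
            - Complex.I * t * x / (1 + (x : ℂ) ^ 2)) ∂M := by
  have := isFiniteMeasure_khintchineMeasure σsq hM
  rw [levyExponent, integral_khintchineMeasure (integrable_levyKernel _ t)]
  simp_rw [ofReal_mul_levyKernel]
  rw [levyKernel, if_pos rfl]
  ring

lemma HasLevyTriplet.charFun_eq {μ : ProbabilityMeasure ℝ} {a : ℝ} {σsq : ℝ≥0} {M : Measure ℝ}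
    (h : HasLevyTriplet μ a σsq M) (t : ℝ) :
    charFun (μ : Measure ℝ) t = Complex.exp (levyExponent a (khintchineMeasure σsq M) t) := by
  rw [h.2 t, levyExponent_khintchineMeasure a σsq h.1]

lemma integrable_mul_bracket {k : ℕ} (hk : 1 ≤ k) {t : ℝ} (ht : 0 < t) {M : Measure ℝ}
    (hM : IsLevyMeasure M) : Integrable (fun x : ℝ => (x : ℂ) * bracket k t x) M := by
  have := isFiniteMeasure_khintchineMeasure 0 hM
  have h := integrable_mul_of_integrable_khintchineMeasure
    (integrable_khintchineKernel hk ht (khintchineMeasure 0 M))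
  simpa only [ofReal_mul_khintchineKernel] using h

lemma integral_khintchineKernel {k : ℕ} (hk : 1 ≤ k) {t : ℝ} (ht : 0 < t) (σsq : ℝ≥0)
    {M : Measure ℝ} (hM : IsLevyMeasure M) :
    ∫ x : ℝ, khintchineKernel k t x ∂khintchineMeasure σsq M
      = ((σsq : ℝ) : ℂ) / 3 ^ k * (1 / (Complex.I * t)) + ∫ x : ℝ, (x : ℂ) * bracket k t x ∂M := by
  have := isFiniteMeasure_khintchineMeasure σsq hM
  rw [integral_khintchineMeasure (integrable_khintchineKernel hk ht _)]
  simp_rw [ofReal_mul_khintchineKernel]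
  rw [khintchineKernel, if_pos rfl, add_comm, div_mul_div_comm, mul_one_div, mul_one]

/-! ### Characteristic functions of sums and of convolution semigroups -/

lemma charFun_lawOfSum {n : ℕ} (c : Fin n → ℝ) (μ : Fin n → ProbabilityMeasure ℝ) (t : ℝ) :
    charFun (lawOfSum c μ : Measure ℝ) t = ∏ j, charFun (μ j : Measure ℝ) (t * c j) := by
  have hm : Measurable (fun x : Fin n → ℝ => ∑ j, c j * x j) := by fun_prop
  rw [lawOfSum, ProbabilityMeasure.toMeasure_map, ProbabilityMeasure.toMeasure_pi,
    charFun_apply_real, integral_map hm.aemeasurable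
      (Measurable.aestronglyMeasurable (by fun_prop))]
  simp_rw [charFun_apply_real]
  rw [← integral_fintype_prod_eq_prod]
  refine integral_congr_ae (Eventually.of_forall fun x => ?_)
  simp only []
  rw [← Complex.exp_sum]
  congr 1
  push_cast
  rw [Finset.mul_sum, Finset.sum_mul]
  exact Finset.sum_congr rfl fun j _ => by ring

lemma tendsto_charFun_of_tendsto {ι : Type*} {l : Filter ι} {μ : ι → ProbabilityMeasure ℝ}
    {ν : ProbabilityMeasure ℝ} (h : Tendsto μ l (𝓝 ν)) (t : ℝ) :
    Tendsto (fun i => charFun (μ i : Measure ℝ) t) l (𝓝 (charFun (ν : Measure ℝ) t)) := by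
  simp_rw [charFun_eq_integral_innerProbChar]
  exact (ProbabilityMeasure.tendsto_iff_forall_integral_rclike_tendsto ℂ).1 h _

lemma IsLevySemigroup.charFun_add {Y : ℝ≥0 → ProbabilityMeasure ℝ} (hY : IsLevySemigroup Y)
    (s r : ℝ≥0) (t : ℝ) :
    charFun (Y (s + r) : Measure ℝ) t = charFun (Y s : Measure ℝ) t * charFun (Y r : Measure ℝ) t := by
  rw [hY.add, charFun_conv]

lemma IsLevySemigroup.charFun_zero {Y : ℝ≥0 → ProbabilityMeasure ℝ} (hY : IsLevySemigroup Y)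
    (t : ℝ) : charFun (Y 0 : Measure ℝ) t = 1 := by
  rw [hY.zero, charFun_dirac]
  simp

lemma IsLevySemigroup.continuous_charFun {Y : ℝ≥0 → ProbabilityMeasure ℝ}
    (hY : IsLevySemigroup Y) (t : ℝ) : Continuous fun s => charFun (Y s : Measure ℝ) t :=
  continuous_iff_continuousAt.2 fun s => tendsto_charFun_of_tendsto (hY.continuous.tendsto s) t

/-- The primitive has derivative F(0) = 1 at 0, so it is nonzero just to the right of 0. -/
lemma exists_pos_integral_ne_zero {F : ℝ → ℂ} (hF : Continuous F) (h0 : F 0 = 1) :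
    ∃ δ > 0, ∫ r in (0 : ℝ)..δ, F r ≠ 0 := by
  have hd := (hF.integral_hasStrictDerivAt 0 0).hasDerivAt
  have hne := hd.eventually_ne (c := 0) (by rw [h0]; exact one_ne_zero)
  have h1 : ∀ᶠ δ : ℝ in 𝓝[>] 0, ∫ r in (0 : ℝ)..δ, F r ≠ 0 :=
    hne.filter_mono (nhdsWithin_mono (0 : ℝ) fun x (hx : (0 : ℝ) < x) => hx.ne')
  obtain ⟨δ, h, hδ⟩ := (h1.and self_mem_nhdsWithin).exists
  exact ⟨δ, hδ, h⟩

/-- Averaging the functional equation gives F(s) ∫₀^δ F = ∫ₛ^(s+δ) F. The right side is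
differentiable in s, so F satisfies F' = cF on the half-line. -/
lemma exists_eq_exp_of_mul_add {F : ℝ → ℂ} (hF : Continuous F) (h0 : F 0 = 1)
    (hadd : ∀ s r : ℝ, 0 ≤ s → 0 ≤ r → F (s + r) = F s * F r) :
    ∃ c : ℂ, ∀ s : ℝ, 0 ≤ s → F s = Complex.exp (s * c) := by
  obtain ⟨δ, hδ, hI⟩ := exists_pos_integral_ne_zero hF h0
  set P : ℝ → ℂ := fun x => ∫ r in (0 : ℝ)..x, F r with hP
  have hPd : ∀ x, HasDerivAt P (F x) x := fun x => (hF.integral_hasStrictDerivAt 0 x).hasDerivAt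
  have hrep : ∀ s : ℝ, 0 ≤ s → (P (s + δ) - P s) / P δ = F s := by
    intro s hs
    rw [div_eq_iff hI, hP]
    simp only
    rw [intervalIntegral.integral_interval_sub_left (hF.intervalIntegrable _ _)
      (hF.intervalIntegrable _ _), ← intervalIntegral.integral_const_mul]
    have h1 : ∫ r in (0 : ℝ)..δ, F s * F r = ∫ r in (0 : ℝ)..δ, F (s + r) := by
      refine intervalIntegral.integral_congr fun r hr => ?_
      rw [Set.uIcc_of_le hδ.le] at hr
      exact (hadd s r hs hr.1).symm
    rw [h1, intervalIntegral.integral_comp_add_left (fun r => F r) s, add_zero]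
  set c : ℂ := (F δ - 1) / P δ with hc
  refine ⟨c, fun s hs => ?_⟩
  -- The quotient of primitives replaces F because it has a two-sided derivative also at 0, while F
  -- is multiplicative only for nonnegative arguments.
  set G : ℝ → ℂ := fun x => (P (x + δ) - P x) / P δ * Complex.exp (-(x * c)) with hG
  have hGd : ∀ x : ℝ, 0 ≤ x → HasDerivAt G 0 x := by
    intro x hx
    have h1 : HasDerivAt (fun x => (P (x + δ) - P x) / P δ) ((F (x + δ) - F x) / P δ) x :=
      (((hPd (x + δ)).comp_add_const x δ).sub (hPd x)).div_const _
    have h2 : HasDerivAt (fun x : ℝ => Complex.exp (-(x * c))) (Complex.exp (-(x * c)) * -c) x := by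
      have := ((Complex.ofRealCLM.hasDerivAt (x := x)).mul_const c).neg.cexp
      simpa using this
    have h3 := h1.mul h2
    refine h3.congr_deriv ?_
    rw [hrep x hx, hadd x δ hx hδ.le, hc]
    ring
  have hconst := constant_of_has_deriv_right_zero (f := G) (a := 0) (b := s)
    (fun x hx => (hGd x hx.1).continuousAt.continuousWithinAt)
    (fun x hx => (hGd x hx.1).hasDerivWithinAt) s ⟨hs, le_rfl⟩
  have h4 : F s * Complex.exp (-(s * c)) = 1 := by
    have e1 : G s = F s * Complex.exp (-(s * c)) := by rw [hG]; simp only; rw [hrep s hs]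
    have e2 : G 0 = 1 := by rw [hG]; simp only; rw [hrep 0 le_rfl, h0]; simp
    rw [← e1, hconst, e2]
  rw [Complex.exp_neg, mul_inv_eq_one₀ (Complex.exp_ne_zero _)] at h4
  exact h4

/-- The characteristic functions of a weakly continuous convolution semigroup are `exp (s η)` for a
continuous `η`. -/
lemma IsLevySemigroup.exists_exponent {Y : ℝ≥0 → ProbabilityMeasure ℝ} (hY : IsLevySemigroup Y) :
    ∃ η : ℝ → ℂ, Continuous η ∧ η 0 = 0 ∧
      ∀ (s : ℝ≥0) (t : ℝ), charFun (Y s : Measure ℝ) t = Complex.exp (s * η t) := by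
  set F : ℝ → ℝ → ℂ := fun t s => charFun (Y s.toNNReal : Measure ℝ) t with hFdef
  have hF : ∀ t, Continuous (F t) := fun t =>
    (hY.continuous_charFun t).comp continuous_real_toNNReal
  have hF0 : ∀ t, F t 0 = 1 := fun t => by simp [hFdef, hY.charFun_zero]
  have hex : ∀ t, ∃ c : ℂ, ∀ s : ℝ, 0 ≤ s → F t s = Complex.exp (s * c) := fun t =>
    exists_eq_exp_of_mul_add (hF t) (hF0 t) fun s r hs hr => by
      simp only [hFdef]
      rw [Real.toNNReal_add hs hr, hY.charFun_add]
  choose η hη using hex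
  -- `η` was chosen separately for each t. Solving this identity for it gives continuity near any t₀
  -- at which the integral is nonzero, and taking t = 0, δ = 1 gives η(0) = 0.
  have hint : ∀ t δ, 0 ≤ δ → η t * ∫ r in (0 : ℝ)..δ, F t r = F t δ - 1 := by
    intro t δ hδ
    have h1 : ∫ r in (0 : ℝ)..δ, F t r = ∫ r in (0 : ℝ)..δ, Complex.exp (r * η t) := by
      refine intervalIntegral.integral_congr fun r hr => ?_
      rw [Set.uIcc_of_le hδ] at hr
      exact hη t r hr.1
    rw [h1, ← intervalIntegral.integral_const_mul,
      intervalIntegral.integral_eq_sub_of_hasDerivAt (f := fun r : ℝ => Complex.exp (r * η t))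
        (fun r _ => ?_) (Continuous.intervalIntegrable (by fun_prop) _ _), hη t δ hδ]
    · simp
    · have := ((Complex.ofRealCLM.hasDerivAt (x := r)).mul_const (η t)).cexp
      simpa [mul_comm] using this
  have hIc : ∀ δ, Continuous fun t => ∫ r in (0 : ℝ)..δ, F t r := fun δ => by
    refine intervalIntegral.continuous_of_dominated_interval (bound := fun _ => 1)
      (fun t => (hF t).aestronglyMeasurable) ?_ (by simp) ?_
    · exact fun t => Eventually.of_forall fun r _ => norm_charFun_le_one t
    · exact Eventually.of_forall fun r _ => MeasureTheory.continuous_charFun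
  refine ⟨η, ?_, ?_, fun s t => ?_⟩
  · rw [continuous_iff_continuousAt]
    intro t₀
    obtain ⟨δ, hδ, hI⟩ := exists_pos_integral_ne_zero (hF t₀) (hF0 t₀)
    have hc : ContinuousAt (fun t => (F t δ - 1) / ∫ r in (0 : ℝ)..δ, F t r) t₀ := by
      refine ContinuousAt.div ?_ (hIc δ).continuousAt hI
      exact ((MeasureTheory.continuous_charFun (μ := (Y δ.toNNReal : Measure ℝ))).sub
        continuous_const).continuousAt
    refine hc.congr ?_
    filter_upwards [(hIc δ).continuousAt.eventually_ne hI] with t ht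
    rw [div_eq_iff ht, hint t δ hδ.le]
  · have h1 : ∀ r, F 0 r = 1 := fun r => by simp [hFdef]
    have := hint 0 1 zero_le_one
    simpa [h1] using this
  · have := hη t s s.2
    simpa [hFdef] using this

/-- A continuous logarithm is determined by its value at `0`. -/
lemma eq_of_exp_eq_exp {f g : ℝ → ℂ} (hf : Continuous f) (hg : Continuous g) (h0 : f 0 = g 0)
    (h : ∀ t, Complex.exp (f t) = Complex.exp (g t)) : f = g := by
  -- The difference takes values in 2πiℤ; near a point of agreement its modulus is below 2π, so it
  -- vanishes there.
  have hclopen : IsClopen {t | f t = g t} := by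
    refine ⟨isClosed_eq hf hg, isOpen_iff_mem_nhds.2 fun t₀ ht₀ => ?_⟩
    have hd : ∀ᶠ t in 𝓝 t₀, ‖f t - g t‖ < 2 * Real.pi := by
      have hc : Continuous fun t => ‖f t - g t‖ := by fun_prop
      refine (hc.tendsto t₀).eventually_lt_const ?_
      have : f t₀ = g t₀ := ht₀
      simp [this, Real.pi_pos]
    filter_upwards [hd] with t ht
    have h1 : Complex.exp (f t - g t) = 1 := by
      rw [Complex.exp_sub, h t, div_self (Complex.exp_ne_zero _)]
    obtain ⟨n, hn⟩ := Complex.exp_eq_one_iff.1 h1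
    rw [hn] at ht
    have h2 : ‖(n : ℂ) * (2 * Real.pi * Complex.I)‖ = |(n : ℝ)| * (2 * Real.pi) := by
      rw [norm_mul, norm_mul, norm_mul, Complex.norm_I, Complex.norm_real, Complex.norm_intCast,
        Real.norm_of_nonneg Real.pi_pos.le, Complex.norm_ofNat, mul_one]
    rw [h2] at ht
    have h3 : |(n : ℝ)| < 1 := by
      have : (0 : ℝ) < 2 * Real.pi := by positivity
      nlinarith
    have h4 : n = 0 := by
      have : |n| < 1 := by exact_mod_cast h3
      exact Int.abs_lt_one_iff.1 this
    have h5 : f t - g t = 0 := by rw [hn, h4]; simp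
    exact sub_eq_zero.1 h5
  have := hclopen.eq_univ ⟨0, h0⟩
  funext t
  have ht : t ∈ {t | f t = g t} := by rw [this]; trivial
  exact ht

/-- Uniqueness of the continuous logarithm identifies ψ with the exponent of the semigroup, so the
law at time 1 determines the law at every time. -/
lemma IsLevySemigroup.charFun_eq_exp {Y : ℝ≥0 → ProbabilityMeasure ℝ} (hY : IsLevySemigroup Y)
    {ψ : ℝ → ℂ} (hψ : Continuous ψ) (hψ0 : ψ 0 = 0)
    (h : ∀ t, charFun (Y 1 : Measure ℝ) t = Complex.exp (ψ t)) (s : ℝ≥0) (t : ℝ) :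
    charFun (Y s : Measure ℝ) t = Complex.exp (s * ψ t) := by
  obtain ⟨η, hη, hη0, hηY⟩ := hY.exists_exponent
  have : η = ψ := eq_of_exp_eq_exp hη hψ (hη0.trans hψ0.symm) fun t => by
    have := hηY 1 t
    rw [← h t, this]
    simp
  rw [hηY, this]

/-! ### The Lévy–Khintchine formula -/

/-- Mean value inequality on the convex left half-plane, where |exp'| ≤ 1. -/
lemma norm_exp_sub_one_le_of_re_nonpos {z : ℂ} (hz : z.re ≤ 0) : ‖Complex.exp z - 1‖ ≤ ‖z‖ := by
  have := Convex.norm_image_sub_le_of_norm_hasDerivWithin_le (f := Complex.exp)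
    (f' := Complex.exp) (s := {w : ℂ | w.re ≤ 0}) (x := 0) (y := z) (C := 1)
    (fun w _ => (Complex.hasDerivAt_exp w).hasDerivWithinAt) (fun w hw => ?_)
    (convex_halfSpace_re_le 0) (by simp) hz
  · simpa using this
  · rw [Complex.norm_exp]
    exact Real.exp_le_one_iff.2 hw

lemma tendsto_mul_exp_div_sub_one (z : ℂ) :
    Tendsto (fun n : ℕ => ((n : ℂ) + 1) * (Complex.exp (((n : ℂ) + 1)⁻¹ * z) - 1)) atTop (𝓝 z) := by
  have hd : HasDerivAt (fun s : ℂ => Complex.exp (s * z)) z 0 := by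
    have := ((hasDerivAt_id (0 : ℂ)).mul_const z).cexp
    simpa using this
  have h := hasDerivAt_iff_tendsto_slope_zero.1 hd
  have hlim : Tendsto (fun n : ℕ => ((n : ℂ) + 1)⁻¹) atTop (𝓝[≠] 0) := by
    rw [tendsto_nhdsWithin_iff]
    refine ⟨?_, Eventually.of_forall fun n => inv_ne_zero (Nat.cast_add_one_ne_zero n)⟩
    have := tendsto_one_div_add_atTop_nhds_zero_nat (𝕜 := ℂ)
    simpa using this
  refine (h.comp hlim).congr fun n => ?_
  simp

/-- The finite measure `c x² / (1 + x²) ν(dx)`. -/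
noncomputable def scaledMeasure (c : ℝ≥0) (ν : Measure ℝ) : Measure ℝ :=
  c • ν.withDensity fun x => ENNReal.ofReal (x ^ 2 / (1 + x ^ 2))

lemma scaledMeasure_le (c : ℝ≥0) (ν : Measure ℝ) : scaledMeasure c ν ≤ c • ν := by
  unfold scaledMeasure
  have : (ν.withDensity fun x => ENNReal.ofReal (x ^ 2 / (1 + x ^ 2))) ≤ ν := by
    conv_rhs => rw [← withDensity_one (μ := ν)]
    refine withDensity_mono (Eventually.of_forall fun x => ?_)
    rw [Pi.one_apply, ENNReal.ofReal_le_one, div_le_one (by positivity)]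
    linarith
  intro s
  simp only [Measure.smul_apply]
  gcongr

instance isFiniteMeasure_scaledMeasure (c : ℝ≥0) (ν : Measure ℝ) [IsFiniteMeasure ν] :
    IsFiniteMeasure (scaledMeasure c ν) :=
  isFiniteMeasure_of_le _ (scaledMeasure_le c ν)

lemma integral_scaledMeasure (c : ℝ≥0) (ν : Measure ℝ) {E : Type*} [NormedAddCommGroup E]
    [NormedSpace ℝ E] (f : ℝ → E) :
    ∫ x, f x ∂scaledMeasure c ν = (c : ℝ) • ∫ x, (x ^ 2 / (1 + x ^ 2)) • f x ∂ν := by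
  rw [scaledMeasure, integral_smul_nnreal_measure,
    integral_withDensity_eq_integral_toReal_smul measurable_ofReal_sq_div (by simp),
    NNReal.smul_def]
  congr 1
  refine integral_congr_ae (Eventually.of_forall fun x => ?_)
  simp only [ENNReal.toReal_ofReal (by positivity : 0 ≤ x ^ 2 / (1 + x ^ 2))]

lemma integrable_exp_I_mul (ν : Measure ℝ) [IsFiniteMeasure ν] (t : ℝ) :
    Integrable (fun x : ℝ => Complex.exp (Complex.I * t * x)) ν :=
  Integrable.of_bound (Continuous.aestronglyMeasurable (by fun_prop)) 1
    (Eventually.of_forall fun x => (norm_exp_I_mul_mul t x).le)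

lemma charFun_eq_integral_exp_I_mul (ν : Measure ℝ) (t : ℝ) :
    charFun ν t = ∫ x : ℝ, Complex.exp (Complex.I * t * x) ∂ν := by
  rw [charFun_apply_real]
  refine integral_congr_ae (Eventually.of_forall fun x => ?_)
  simp only
  congr 1
  ring

lemma abs_div_one_add_sq_le (x : ℝ) : |x / (1 + x ^ 2)| ≤ 1 := by
  rw [abs_div, abs_of_pos (by positivity : 0 < 1 + x ^ 2), div_le_one (by positivity), ← sq_abs]
  nlinarith [sq_nonneg (|x| - 1), abs_nonneg x]

lemma integrable_div_one_add_sq (ν : Measure ℝ) [IsFiniteMeasure ν] :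
    Integrable (fun x : ℝ => x / (1 + x ^ 2)) ν :=
  Integrable.of_bound (Measurable.aestronglyMeasurable (by fun_prop)) 1
    (Eventually.of_forall fun x => abs_div_one_add_sq_le x)

/-- The compound Poisson exponent c(φ - 1) is already in Khintchine's form; these are the
approximants whose limit yields the Lévy–Khintchine formula. -/
lemma mul_charFun_sub_one (c : ℝ≥0) (ν : Measure ℝ) [IsProbabilityMeasure ν] (t : ℝ) :
    ((c : ℝ) : ℂ) * (charFun ν t - 1)
      = Complex.I * t * ((c * ∫ x, x / (1 + x ^ 2) ∂ν : ℝ) : ℂ)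
        + ∫ x, levyKernel t x ∂scaledMeasure c ν := by
  have h1 : ∀ x : ℝ, Complex.exp (Complex.I * t * x) - 1
      = (x ^ 2 / (1 + x ^ 2)) • levyKernel t x
        + Complex.I * t * ((x / (1 + x ^ 2) : ℝ) : ℂ) := fun x => by
    rw [Complex.real_smul, ofReal_mul_levyKernel]
    push_cast
    ring
  have h2 : charFun ν t - 1 = ∫ x : ℝ, (Complex.exp (Complex.I * t * x) - 1) ∂ν := by
    rw [integral_sub (integrable_exp_I_mul ν t) (integrable_const _),
      ← charFun_eq_integral_exp_I_mul]
    simp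
  have hi : Integrable (fun x : ℝ => (x ^ 2 / (1 + x ^ 2)) • levyKernel t x) ν := by
    refine Integrable.mono (integrable_levyKernel ν t)
      (AEStronglyMeasurable.smul
        (Measurable.aestronglyMeasurable (f := fun x : ℝ => x ^ 2 / (1 + x ^ 2)) (by fun_prop))
        (continuous_levyKernel t).aestronglyMeasurable) (Eventually.of_forall fun x => ?_)
    rw [norm_smul, Real.norm_of_nonneg (by positivity)]
    refine mul_le_of_le_one_left (norm_nonneg _) ?_
    rw [div_le_one (by positivity)]
    linarith
  have hj : Integrable (fun x : ℝ => Complex.I * t * ((x / (1 + x ^ 2) : ℝ) : ℂ)) ν :=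
    (integrable_div_one_add_sq ν).ofReal.const_mul _
  rw [h2]
  simp_rw [h1]
  rw [integral_add hi hj, integral_const_mul, integral_complex_ofReal, integral_scaledMeasure,
    Complex.real_smul]
  push_cast
  ring

/-- For |x| ≤ 1 one has 1 - cos x ≥ 2x²/π² ≥ x²/5, since π² ≤ 10. -/
lemma sq_div_le_indicator_add (x : ℝ) :
    x ^ 2 / (1 + x ^ 2) ≤ {x : ℝ | 1 < |x|}.indicator (fun _ => (1 : ℝ)) x
      + 5 * (1 - Real.cos x) := by
  have hc := Real.cos_le_one x
  by_cases hx : 1 < |x|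
  · have hmem : x ∈ {x : ℝ | 1 < |x|} := hx
    rw [Set.indicator_of_mem hmem]
    have : x ^ 2 / (1 + x ^ 2) ≤ 1 := by
      rw [div_le_one (by positivity)]
      linarith
    linarith
  · have hmem : x ∉ {x : ℝ | 1 < |x|} := hx
    rw [Set.indicator_of_notMem hmem]
    push Not at hx
    have h1 := Real.cos_le_one_sub_mul_cos_sq (hx.trans (by linarith [Real.pi_gt_three]))
    have h2 : x ^ 2 / (1 + x ^ 2) ≤ x ^ 2 := div_le_self (sq_nonneg x) (by linarith [sq_nonneg x])
    have h3 : 1 / 5 ≤ 2 / Real.pi ^ 2 := by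
      rw [div_le_div_iff₀ (by norm_num) (by positivity)]
      nlinarith [Real.pi_lt_d2, Real.pi_pos]
    nlinarith [mul_le_mul_of_nonneg_right h3 (sq_nonneg x)]

lemma real_scaledMeasure_univ_le (c : ℝ≥0) (ν : Measure ℝ) [IsProbabilityMeasure ν] :
    (scaledMeasure c ν).real Set.univ
      ≤ c * ν.real {x | 1 < |x|} + 5 * ‖((c : ℝ) : ℂ) * (charFun ν 1 - 1)‖ := by
  have hms : MeasurableSet {x : ℝ | 1 < |x|} := measurableSet_lt measurable_const measurable_norm
  have h1 : (scaledMeasure c ν).real Set.univ = c * ∫ x, x ^ 2 / (1 + x ^ 2) ∂ν := by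
    have := integral_scaledMeasure c ν (fun _ => (1 : ℝ))
    simpa using this
  have hcos : Integrable (fun x : ℝ => Real.cos x) ν :=
    Integrable.of_bound (Continuous.aestronglyMeasurable (by fun_prop)) 1
      (Eventually.of_forall fun x => Real.abs_cos_le_one x)
  have hind : Integrable ({x : ℝ | 1 < |x|}.indicator (fun _ => (1 : ℝ))) ν :=
    (integrable_const _).indicator hms
  have hi : Integrable (fun x : ℝ => 5 * (1 - Real.cos x)) ν :=
    ((integrable_const _).sub hcos).const_mul _
  have h2 : ∫ x, x ^ 2 / (1 + x ^ 2) ∂ν ≤ ν.real {x | 1 < |x|} + 5 * ∫ x, (1 - Real.cos x) ∂ν := by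
    have := integral_mono_of_nonneg (μ := ν) (Eventually.of_forall fun x => by positivity)
      (hind.add hi) (Eventually.of_forall sq_div_le_indicator_add)
    simp only [Pi.add_apply] at this
    rwa [integral_add hind hi, integral_indicator_const _ hms, smul_eq_mul, mul_one,
      integral_const_mul] at this
  have h3 : ∫ x, (1 - Real.cos x) ∂ν ≤ ‖charFun ν 1 - 1‖ := by
    have e : ∫ x, (1 - Real.cos x) ∂ν = (1 - charFun ν 1).re := by
      have e1 : (charFun ν 1).re = ∫ x, Real.cos x ∂ν := by
        rw [charFun_apply_real, ← Complex.reCLM_apply, ← ContinuousLinearMap.integral_comp_comm]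
        · refine integral_congr_ae (Eventually.of_forall fun x => ?_)
          simp [Complex.exp_ofReal_mul_I_re]
        · have := integrable_exp_I_mul ν 1
          refine this.congr (Eventually.of_forall fun x => ?_)
          simp only
          congr 1
          ring
      rw [integral_sub (integrable_const _) hcos, Complex.sub_re, e1]
      simp
    rw [e, norm_sub_rev]
    exact Complex.re_le_norm _
  rw [h1, norm_mul, Complex.norm_real, Real.norm_of_nonneg c.coe_nonneg]
  have hc : (0 : ℝ) ≤ c := c.2
  nlinarith [mul_le_mul_of_nonneg_left h2 hc, mul_le_mul_of_nonneg_left h3 hc]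

/-- The truncation inequality bounds the tail by r/2 times an integral over an interval of length
4/r, hence the factor 2. -/
lemma mul_real_abs_gt_le (c : ℝ≥0) (ν : Measure ℝ) [IsProbabilityMeasure ν] {r B : ℝ} (hr : 0 < r)
    (hB : ∀ t, |t| ≤ 2 * r⁻¹ → ‖((c : ℝ) : ℂ) * (charFun ν t - 1)‖ ≤ B) :
    c * ν.real {x | r < |x|} ≤ 2 * B := by
  have h1 := measureReal_abs_gt_le_integral_charFun (μ := ν) hr
  have h2 : ‖∫ t in -2 * r⁻¹..2 * r⁻¹, ((c : ℝ) : ℂ) * (1 - charFun ν t)‖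
      ≤ B * |2 * r⁻¹ - -2 * r⁻¹| := by
    refine intervalIntegral.norm_integral_le_of_norm_le_const fun t ht => ?_
    have hr' : 0 < r⁻¹ := inv_pos.2 hr
    rw [Set.uIoc_of_le (by linarith)] at ht
    have := hB t (abs_le.2 ⟨by linarith [ht.1], ht.2⟩)
    rwa [norm_mul, norm_sub_rev, ← norm_mul] at this
  rw [intervalIntegral.integral_const_mul, norm_mul, Complex.norm_real,
    Real.norm_of_nonneg c.coe_nonneg] at h2
  have h3 : |2 * r⁻¹ - -2 * r⁻¹| = 4 * r⁻¹ := by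
    rw [abs_of_nonneg (by have : 0 < r⁻¹ := inv_pos.2 hr
                          linarith)]
    ring
  rw [h3] at h2
  calc c * ν.real {x | r < |x|}
      ≤ c * (2⁻¹ * r * ‖∫ t in -2 * r⁻¹..2 * r⁻¹, 1 - charFun ν t‖) :=
        mul_le_mul_of_nonneg_left h1 c.2
    _ = 2⁻¹ * r * (c * ‖∫ t in -2 * r⁻¹..2 * r⁻¹, 1 - charFun ν t‖) := by ring
    _ ≤ 2⁻¹ * r * (B * (4 * r⁻¹)) := by gcongr
    _ = 2 * B := by
      field_simp
      ring

/-- The **Lévy–Khintchine formula** for the exponent of a convolution semigroup. -/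
theorem IsLevySemigroup.exists_levyExponent {Y : ℝ≥0 → ProbabilityMeasure ℝ}
    (hY : IsLevySemigroup Y) :
    ∃ (a : ℝ) (m : Measure ℝ), IsFiniteMeasure m ∧
      ∀ t, charFun (Y 1 : Measure ℝ) t = Complex.exp (levyExponent a m t) := by
  obtain ⟨η, hη, hη0, hηY⟩ := hY.exists_exponent
  -- With ν n the law at time 1/(n+1), the exponents c(φ - 1) converge to η and are bounded by |η|
  -- uniformly in n.
  set c : ℕ → ℝ≥0 := fun n => n + 1 with hc
  set ν : ℕ → ProbabilityMeasure ℝ := fun n => Y (c n)⁻¹ with hν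
  have hcc : ∀ n, ((c n : ℝ) : ℂ) = (n : ℂ) + 1 := fun n => by simp [hc]
  have hφ : ∀ n t, ((c n : ℝ) : ℂ) * (charFun (ν n : Measure ℝ) t - 1)
      = ((n : ℂ) + 1) * (Complex.exp (((n : ℂ) + 1)⁻¹ * η t) - 1) := fun n t => by
    simp only [hν]
    rw [hηY, hcc]
    congr 4
    rw [NNReal.coe_inv, Complex.ofReal_inv, hcc]
  have hre : ∀ t, (η t).re ≤ 0 := fun t => by
    have h1 : ‖charFun (Y 1 : Measure ℝ) t‖ ≤ 1 := norm_charFun_le_one t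
    rw [hηY, Complex.norm_exp, Real.exp_le_one_iff] at h1
    simpa using h1
  have hbound : ∀ n t, ‖((c n : ℝ) : ℂ) * (charFun (ν n : Measure ℝ) t - 1)‖ ≤ ‖η t‖ := by
    intro n t
    have hpos : (0 : ℝ) < ((n : ℝ) + 1) := by positivity
    have hcast : ((n : ℂ) + 1) = (((n : ℝ) + 1 : ℝ) : ℂ) := by push_cast; rfl
    have hle : (((n : ℂ) + 1)⁻¹ * η t).re ≤ 0 := by
      rw [hcast, ← Complex.ofReal_inv, Complex.re_ofReal_mul]
      exact mul_nonpos_of_nonneg_of_nonpos (by positivity) (hre t)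
    rw [hφ, norm_mul]
    calc ‖(n : ℂ) + 1‖ * ‖Complex.exp (((n : ℂ) + 1)⁻¹ * η t) - 1‖
        ≤ ‖(n : ℂ) + 1‖ * ‖((n : ℂ) + 1)⁻¹ * η t‖ := by
          gcongr
          exact norm_exp_sub_one_le_of_re_nonpos hle
      _ = ‖η t‖ := by
          rw [norm_mul, norm_inv, mul_inv_cancel_left₀]
          exact norm_ne_zero_iff.2 (Nat.cast_add_one_ne_zero n)
  -- Continuity of η at 0 with η(0) = 0 supplies the radii r_j beyond which all the scaled measures
  -- have mass at most 2/(j+1).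
  have hsmall : ∀ j : ℕ, ∃ r : ℝ, 0 < r ∧ ∀ t, |t| ≤ 2 * r⁻¹ → ‖η t‖ ≤ 1 / ((j : ℝ) + 1) := by
    intro j
    have hev : ∀ᶠ t in 𝓝 (0 : ℝ), ‖η t‖ < 1 / ((j : ℝ) + 1) := by
      refine ((hη.norm).tendsto 0).eventually_lt_const ?_
      rw [hη0, norm_zero]
      positivity
    obtain ⟨ε, hε, hball⟩ := Metric.eventually_nhds_iff.1 hev
    refine ⟨4 / ε, by positivity, fun t ht => (hball ?_).le⟩
    rw [Real.dist_eq, sub_zero]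
    have : 2 * (4 / ε)⁻¹ = ε / 2 := by
      field_simp
      norm_num
    linarith
  choose r hr hrη using hsmall
  obtain ⟨B, hB⟩ := (isCompact_Icc (a := (-2 : ℝ)) (b := 2)).exists_bound_of_continuousOn
    hη.continuousOn
  have hB0 : 0 ≤ B := (norm_nonneg _).trans (hB 0 (by constructor <;> norm_num))
  set mm : ℕ → FiniteMeasure ℝ := fun n => ⟨scaledMeasure (c n) (ν n : Measure ℝ), inferInstance⟩
    with hmm
  -- Prokhorov's theorem. In the mass bound, 2B comes from the tail at radius 1 and 5B from the
  -- integral of 5(1 - cos x).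
  have hcompact : IsCompact {ρ : FiniteMeasure ℝ | ρ.mass ≤ (2 * B + 5 * B).toNNReal ∧
      ∀ j : ℕ, ρ (Set.Icc (-r j) (r j))ᶜ ≤ (2 * (1 / ((j : ℝ) + 1))).toNNReal} := by
    refine isCompact_setOfPred_finiteMeasure_mass_le_compl_isCompact_le _ ?_
      (fun j => isCompact_Icc) (Or.inl inferInstance)
    have h1 : Tendsto (fun j : ℕ => 2 * (1 / ((j : ℝ) + 1))) atTop (𝓝 (2 * 0)) :=
      tendsto_one_div_add_atTop_nhds_zero_nat.const_mul 2
    rw [mul_zero] at h1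
    rw [← Real.toNNReal_zero]
    exact (continuous_real_toNNReal.tendsto 0).comp h1
  have hmem : ∀ n, mm n ∈ {ρ : FiniteMeasure ℝ | ρ.mass ≤ (2 * B + 5 * B).toNNReal ∧
      ∀ j : ℕ, ρ (Set.Icc (-r j) (r j))ᶜ ≤ (2 * (1 / ((j : ℝ) + 1))).toNNReal} := by
    intro n
    refine ⟨?_, fun j => ?_⟩
    · rw [← NNReal.coe_le_coe, Real.coe_toNNReal _ (by positivity)]
      have h1 := real_scaledMeasure_univ_le (c n) (ν n : Measure ℝ)
      have h2 := mul_real_abs_gt_le (c n) (ν n : Measure ℝ) (r := 1) (B := B) one_pos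
        (fun t ht => (hbound n t).trans (hB t (by
          rw [inv_one, mul_one] at ht
          exact abs_le.1 ht)))
      have h3 := (hbound n 1).trans (hB 1 (by constructor <;> norm_num))
      have h4 : ((mm n).mass : ℝ) = (scaledMeasure (c n) (ν n : Measure ℝ)).real Set.univ := rfl
      rw [h4]
      linarith
    · rw [← NNReal.coe_le_coe, Real.coe_toNNReal _ (by positivity)]
      have h4 : ((mm n (Set.Icc (-r j) (r j))ᶜ : ℝ≥0) : ℝ)
          = (scaledMeasure (c n) (ν n : Measure ℝ)).real (Set.Icc (-r j) (r j))ᶜ := rfl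
      have h5 : (scaledMeasure (c n) (ν n : Measure ℝ)).real (Set.Icc (-r j) (r j))ᶜ
          ≤ c n * (ν n : Measure ℝ).real {x | r j < |x|} := by
        have hset : (Set.Icc (-r j) (r j))ᶜ = {x : ℝ | r j < |x|} := by
          ext x
          simp only [Set.mem_compl_iff, Set.mem_Icc, Set.mem_ofPred_eq, ← abs_le, not_le]
        rw [hset, ← measureReal_nnreal_smul_apply]
        exact ENNReal.toReal_mono (measure_ne_top _ _) (scaledMeasure_le _ _ _)
      rw [h4]
      exact h5.trans (mul_real_abs_gt_le (c n) (ν n : Measure ℝ) (hr j)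
        fun t ht => (hbound n t).trans (hrη j t ht))
  obtain ⟨m, -, hm⟩ := hcompact.ultrafilter_le_nhds ((hyperfilter ℕ).map mm) (by
    rw [Ultrafilter.coe_map, le_principal_iff]
    exact Filter.mem_map.2 (Eventually.of_forall hmem))
  have hm' : Tendsto mm (hyperfilter ℕ : Filter ℕ) (𝓝 m) := hm
  have hK : ∀ t, Tendsto (fun n => ∫ x, levyKernel t x ∂scaledMeasure (c n) (ν n : Measure ℝ))
      (hyperfilter ℕ : Filter ℕ) (𝓝 (∫ x, levyKernel t x ∂(m : Measure ℝ))) := fun t =>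
    (FiniteMeasure.tendsto_iff_forall_integral_rclike_tendsto ℂ).1 hm'
      (BoundedContinuousFunction.ofNormedAddCommGroup (levyKernel t) (continuous_levyKernel t) _
        (norm_levyKernel_le t))
  have hL : ∀ t, Tendsto (fun n => ((c n : ℝ) : ℂ) * (charFun (ν n : Measure ℝ) t - 1))
      (hyperfilter ℕ : Filter ℕ) (𝓝 (η t)) := fun t => by
    simp_rw [hφ]
    exact (tendsto_mul_exp_div_sub_one (η t)).mono_left Nat.hyperfilter_le_atTop
  set a : ℕ → ℝ := fun n => c n * ∫ x, x / (1 + x ^ 2) ∂(ν n : Measure ℝ) with ha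
  have hid : ∀ n t, ((c n : ℝ) : ℂ) * (charFun (ν n : Measure ℝ) t - 1)
      = Complex.I * t * (a n : ℂ)
        + ∫ x, levyKernel t x ∂scaledMeasure (c n) (ν n : Measure ℝ) := fun n t =>
    mul_charFun_sub_one (c n) (ν n : Measure ℝ) t
  -- The drifts converge without a separate bound: at t = 1 the identity `hid` expresses them as
  -- imaginary parts of a convergent quantity.
  have hat : Tendsto a (hyperfilter ℕ : Filter ℕ)
      (𝓝 (η 1 - ∫ x, levyKernel 1 x ∂(m : Measure ℝ)).im) := by
    have h1 := Complex.continuous_im.continuousAt.tendsto.comp ((hL 1).sub (hK 1))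
    refine h1.congr fun n => ?_
    simp [hid]
  refine ⟨(η 1 - ∫ x, levyKernel 1 x ∂(m : Measure ℝ)).im, (m : Measure ℝ), inferInstance,
    fun t => ?_⟩
  rw [hηY 1 t]
  have h1 : Tendsto (fun n => ((c n : ℝ) : ℂ) * (charFun (ν n : Measure ℝ) t - 1))
      (hyperfilter ℕ : Filter ℕ)
      (𝓝 (levyExponent (η 1 - ∫ x, levyKernel 1 x ∂(m : Measure ℝ)).im m t)) := by
    simp_rw [hid]
    refine Tendsto.add (Tendsto.const_mul _ ?_) (hK t)
    exact (Complex.continuous_ofReal.tendsto _).comp hat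
  rw [tendsto_nhds_unique (hL t) h1]
  simp

/-! ### Existence of infinitely divisible laws -/

/-- **Lévy's continuity theorem**, with the existence of the limit law. -/
lemma exists_tendsto_of_tendsto_charFun {μ : ℕ → ProbabilityMeasure ℝ} {f : ℝ → ℂ}
    (hf : ContinuousAt f 0)
    (h : ∀ t, Tendsto (fun n => charFun (μ n : Measure ℝ) t) atTop (𝓝 (f t))) :
    ∃ ν : ProbabilityMeasure ℝ, Tendsto μ atTop (𝓝 ν) ∧ ∀ t, charFun (ν : Measure ℝ) t = f t := by
  have htight := isTightMeasureSet_of_tendsto_charFun hf h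
  have hcomp : IsCompact (closure (Set.range μ)) := by
    refine isCompact_closure_of_isTightMeasureSet (htight.subset ?_)
    rintro _ ⟨_, ⟨n, rfl⟩, rfl⟩
    exact ⟨n, rfl⟩
  obtain ⟨ν, -, hν⟩ := hcomp.ultrafilter_le_nhds ((hyperfilter ℕ).map μ) (by
    rw [Ultrafilter.coe_map, le_principal_iff]
    exact Filter.mem_map.2 (Eventually.of_forall fun n => subset_closure ⟨n, rfl⟩))
  have hν' : Tendsto μ (hyperfilter ℕ : Filter ℕ) (𝓝 ν) := hν
  have hchar : ∀ t, charFun (ν : Measure ℝ) t = f t := fun t =>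
    tendsto_nhds_unique (tendsto_charFun_of_tendsto hν' t)
      ((h t).mono_left Nat.hyperfilter_le_atTop)
  exact ⟨ν, ProbabilityMeasure.tendsto_of_tendsto_charFun fun t => by rw [hchar]; exact h t, hchar⟩

/-- Take N/n and put the missing mass at 0. The n-fold convolution powers then approximate the
compound Poisson law, by (1 + z/n)ⁿ → e^z. -/
lemma exists_charFun_eq_one_add (N : Measure ℝ) [IsFiniteMeasure N] {n : ℕ} (hn : 0 < n)
    (hN : N.real Set.univ ≤ n) :
    ∃ P : ProbabilityMeasure ℝ, ∀ t : ℝ, charFun (P : Measure ℝ) t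
      = 1 + (n : ℂ)⁻¹ * ∫ x : ℝ, (Complex.exp (Complex.I * t * x) - 1) ∂N := by
  have hn0 : (n : ℝ≥0) ≠ 0 := by exact_mod_cast hn.ne'
  obtain ⟨l, hl⟩ : ∃ l : ℝ≥0, N Set.univ = l := ⟨_, (ENNReal.coe_toNNReal (measure_ne_top N _)).symm⟩
  have hlr : N.real Set.univ = l := by rw [Measure.real, hl]; rfl
  have hle : (n : ℝ≥0)⁻¹ * l ≤ 1 := by
    rw [inv_mul_le_iff₀ (by positivity), mul_one]
    rw [hlr] at hN
    exact_mod_cast hN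
  set P : Measure ℝ := (1 - (n : ℝ≥0)⁻¹ * l) • Measure.dirac (0 : ℝ) + (n : ℝ≥0)⁻¹ • N with hP
  have hprob : IsProbabilityMeasure P := by
    refine ⟨?_⟩
    rw [hP, Measure.add_apply, Measure.smul_apply, Measure.smul_apply, hl, measure_univ,
      ENNReal.smul_def, ENNReal.smul_def, smul_eq_mul, smul_eq_mul, mul_one, ← ENNReal.coe_mul,
      ← ENNReal.coe_add, tsub_add_cancel_of_le hle, ENNReal.coe_one]
  refine ⟨⟨P, hprob⟩, fun t => ?_⟩
  have hP' : charFun P t = ((1 - (n : ℝ)⁻¹ * l : ℝ) : ℂ)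
      + (n : ℂ)⁻¹ * ∫ x : ℝ, Complex.exp (Complex.I * t * x) ∂N := by
    rw [charFun_eq_integral_exp_I_mul, hP, integral_add_measure, integral_smul_nnreal_measure,
      integral_smul_nnreal_measure, integral_dirac, NNReal.smul_def, NNReal.smul_def,
      Complex.real_smul, Complex.real_smul, NNReal.coe_sub hle]
    · push_cast
      simp
    · exact (integrable_exp_I_mul _ t)
    · exact (integrable_exp_I_mul N t).smul_measure_nnreal
  change charFun P t = _
  rw [hP', integral_sub (integrable_exp_I_mul N t) (integrable_const _), integral_const, hlr]
  simp only [Complex.real_smul, mul_one]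
  push_cast
  ring

/-- Compound Poisson laws. -/
lemma exists_charFun_eq_exp_integral (N : Measure ℝ) [IsFiniteMeasure N] :
    ∃ μ : ProbabilityMeasure ℝ, ∀ t : ℝ, charFun (μ : Measure ℝ) t
      = Complex.exp (∫ x : ℝ, (Complex.exp (Complex.I * t * x) - 1) ∂N) := by
  have hex : ∀ n : ℕ, ∃ P : ProbabilityMeasure ℝ, 0 < n → N.real Set.univ ≤ n → ∀ t : ℝ,
      charFun (P : Measure ℝ) t
        = 1 + (n : ℂ)⁻¹ * ∫ x : ℝ, (Complex.exp (Complex.I * t * x) - 1) ∂N := by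
    intro n
    by_cases h : 0 < n ∧ N.real Set.univ ≤ n
    · obtain ⟨P, hP⟩ := exists_charFun_eq_one_add N h.1 h.2
      exact ⟨P, fun _ _ => hP⟩
    · exact ⟨⟨Measure.dirac 0, inferInstance⟩, fun h1 h2 => absurd ⟨h1, h2⟩ h⟩
  choose P hP using hex
  have hcont : Continuous fun t : ℝ => ∫ x : ℝ, (Complex.exp (Complex.I * t * x) - 1) ∂N := by
    refine continuous_of_dominated (bound := fun _ => 2)
      (fun t => Continuous.aestronglyMeasurable (by fun_prop))
      (fun t => Eventually.of_forall fun x => ?_) (integrable_const _)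
      (Eventually.of_forall fun x => by fun_prop)
    refine (norm_sub_le _ _).trans ?_
    rw [norm_exp_I_mul_mul, norm_one]
    norm_num
  obtain ⟨μ, -, hμ⟩ := exists_tendsto_of_tendsto_charFun
    (μ := fun n => lawOfSum (fun _ : Fin n => 1) (fun _ => P n))
    (f := fun t => Complex.exp (∫ x : ℝ, (Complex.exp (Complex.I * t * x) - 1) ∂N))
    hcont.cexp.continuousAt fun t => by
      have hlim := Complex.tendsto_one_add_pow_exp_of_tendsto
        (g := fun n : ℕ => (n : ℂ)⁻¹ * ∫ x : ℝ, (Complex.exp (Complex.I * t * x) - 1) ∂N)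
        (t := ∫ x : ℝ, (Complex.exp (Complex.I * t * x) - 1) ∂N) (by
          refine tendsto_const_nhds.congr' ?_
          filter_upwards [eventually_gt_atTop 0] with n hn
          have : (n : ℂ) ≠ 0 := by exact_mod_cast hn.ne'
          rw [mul_inv_cancel_left₀ this])
      refine hlim.congr' ?_
      filter_upwards [eventually_gt_atTop 0,
        tendsto_natCast_atTop_atTop.eventually_ge_atTop (N.real Set.univ)] with n hn hn'
      rw [charFun_lawOfSum]
      simp [hP n hn hn']
  exact ⟨μ, hμ⟩

/-- The converse part of the Lévy–Khintchine formula. -/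
theorem exists_charFun_eq_exp_levyExponent (a : ℝ) (m : Measure ℝ) [IsFiniteMeasure m] :
    ∃ μ : ProbabilityMeasure ℝ, ∀ t : ℝ, charFun (μ : Measure ℝ) t
      = Complex.exp (levyExponent a m t) := by
  -- Away from 0 the Lévy measure (1 + x²)/x² m(dx) is finite, so it has a compound Poisson law. A
  -- Gaussian factor carries the atom of m at 0, and the truncation is then removed.
  set A : ℕ → Set ℝ := fun n => {x : ℝ | 1 / ((n : ℝ) + 1) < |x|} with hA
  have hAm : ∀ n, MeasurableSet (A n) := fun n => measurableSet_lt measurable_const measurable_norm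
  set d : ℝ → ENNReal := fun x => ENNReal.ofReal ((1 + x ^ 2) / x ^ 2) with hd
  have hdm : Measurable d := by fun_prop
  set N : ℕ → Measure ℝ := fun n => (m.restrict (A n)).withDensity d with hN
  have hinv : ∀ n, ∀ x ∈ A n, |x⁻¹| ≤ (n : ℝ) + 1 := fun n x hx => by
    have hx' : 1 / ((n : ℝ) + 1) < |x| := hx
    rw [abs_inv, inv_le_comm₀ (lt_trans (by positivity) hx') (by positivity), ← one_div]
    exact hx'.le
  have hne : ∀ n, ∀ x ∈ A n, x ≠ 0 := fun n x hx => by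
    have hx' : 1 / ((n : ℝ) + 1) < |x| := hx
    exact abs_pos.1 (lt_trans (by positivity) hx')
  have hNfin : ∀ n, IsFiniteMeasure (N n) := fun n => by
    refine isFiniteMeasure_withDensity (lt_of_le_of_lt
      (lintegral_mono_ae (g := fun _ => ENNReal.ofReal (1 + ((n : ℝ) + 1) ^ 2)) ?_) ?_).ne
    · filter_upwards [ae_restrict_mem (hAm n)] with x hx
      refine ENNReal.ofReal_le_ofReal ?_
      have h1 : (1 + x ^ 2) / x ^ 2 = 1 + |x⁻¹| ^ 2 := by
        have := hne n x hx
        rw [sq_abs]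
        field_simp
        ring
      rw [h1]
      gcongr
      exact hinv n x hx
    · rw [lintegral_const]
      exact ENNReal.mul_lt_top ENNReal.ofReal_lt_top (measure_lt_top _ _)
  have hinvint : ∀ n, IntegrableOn (fun x : ℝ => x⁻¹) (A n) m := fun n =>
    Integrable.of_bound (Measurable.aestronglyMeasurable (by fun_prop)) _
      ((ae_restrict_mem (hAm n)).mono fun x hx => hinv n x hx)
  have hNint : ∀ n (t : ℝ), ∫ x : ℝ, (Complex.exp (Complex.I * t * x) - 1) ∂N n
      = ∫ x in A n, levyKernel t x ∂m
        + Complex.I * t * ((∫ x in A n, x⁻¹ ∂m : ℝ) : ℂ) := fun n t => by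
    have hi : IntegrableOn (fun x : ℝ => Complex.I * t * ((x⁻¹ : ℝ) : ℂ)) (A n) m :=
      ((hinvint n).ofReal (𝕜 := ℂ)).const_mul _
    rw [hN, integral_withDensity_eq_integral_toReal_smul hdm (by simp [hd]),
      ← integral_complex_ofReal, ← integral_const_mul, ← integral_add
        (integrable_levyKernel m t).integrableOn hi]
    refine setIntegral_congr_fun (hAm n) fun x hx => ?_
    have hx0 := hne n x hx
    have hxc : (x : ℂ) ≠ 0 := by exact_mod_cast hx0
    have h1 := one_add_sq_ne_zero x
    simp only [hd]
    rw [ENNReal.toReal_ofReal (by positivity), levyKernel, if_neg hx0, Complex.real_smul]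
    push_cast
    field_simp
    ring
  choose Q hQ using fun n => exists_charFun_eq_exp_integral (N n)
  set v : ℝ≥0 := (m {0}).toNNReal with hv
  -- The centering x/(1 + x²) times (1 + x²)/x² is 1/x; its integral is subtracted here to cancel
  -- the extra drift in `hNint`.
  set α : ℕ → ℝ := fun n => a - ∫ x in A n, x⁻¹ ∂m with hα
  set R : ℕ → ProbabilityMeasure ℝ := fun n =>
    ⟨((Q n : Measure ℝ).conv (ProbabilityTheory.gaussianReal (α n) v)), inferInstance⟩ with hR
  have hchar : ∀ n t, charFun (R n : Measure ℝ) t = Complex.exp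
      (Complex.I * t * a + ((∫ x in A n, levyKernel t x ∂m) - v * (t : ℂ) ^ 2 / 2)) := by
    intro n t
    have h1 : charFun (R n : Measure ℝ) t
        = charFun (Q n : Measure ℝ) t * charFun (ProbabilityTheory.gaussianReal (α n) v) t :=
      charFun_conv t
    rw [h1, hQ, hNint, ProbabilityTheory.charFun_gaussianReal, ← Complex.exp_add, hα]
    congr 1
    push_cast
    ring
  have hlim : ∀ t, Tendsto (fun n => ∫ x in A n, levyKernel t x ∂m) atTop
      (𝓝 (∫ x in {0}ᶜ, levyKernel t x ∂m)) := fun t => by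
    have hU : ⋃ n, A n = {0}ᶜ := by
      ext x
      simp only [Set.mem_iUnion, Set.mem_compl_iff, Set.mem_singleton_iff]
      exact ⟨fun ⟨n, hn⟩ => hne n x hn, fun hx => exists_nat_one_div_lt (abs_pos.2 hx)⟩
    rw [← hU]
    refine tendsto_setIntegral_of_monotone hAm (fun i j hij x hx => ?_)
      (integrable_levyKernel m t).integrableOn
    have hx' : 1 / ((i : ℝ) + 1) < |x| := hx
    exact lt_of_le_of_lt (Nat.one_div_le_one_div hij) hx'
  obtain ⟨μ, -, hμ⟩ := exists_tendsto_of_tendsto_charFun (μ := R)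
    (f := fun t => Complex.exp (levyExponent a m t))
    (by have := continuous_levyExponent a m
        fun_prop) fun t => by
      simp_rw [hchar]
      refine (Complex.continuous_exp.tendsto _).comp (Tendsto.add tendsto_const_nhds ?_)
      have h0 : ∫ x in {0}, levyKernel t x ∂m = -(v * (t : ℂ) ^ 2 / 2) := by
        rw [integral_singleton, levyKernel, if_pos rfl, Complex.real_smul]
        have : m.real {0} = v := rfl
        rw [this]
        ring
      have h2 := integral_add_compl (measurableSet_singleton (0 : ℝ)) (integrable_levyKernel m t)
      rw [← h2, h0, add_comm, ← sub_eq_add_neg]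
      exact (hlim t).sub_const _
  exact ⟨μ, hμ⟩

lemma probabilityMeasure_ext_of_charFun {μ ν : ProbabilityMeasure ℝ}
    (h : ∀ t, charFun (μ : Measure ℝ) t = charFun (ν : Measure ℝ) t) : μ = ν :=
  ProbabilityMeasure.toMeasure_injective (Measure.ext_of_charFun (funext h))

/-- Every exponent is that of a convolution semigroup. -/
lemma exists_isLevySemigroup (a : ℝ) (m : Measure ℝ) [IsFiniteMeasure m] :
    ∃ Y : ℝ≥0 → ProbabilityMeasure ℝ, IsLevySemigroup Y ∧
      ∀ s t, charFun (Y s : Measure ℝ) t = Complex.exp (s * levyExponent a m t) := by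
  choose Y hY using fun s : ℝ≥0 => exists_charFun_eq_exp_levyExponent (s * a) (s • m)
  simp_rw [levyExponent_smul] at hY
  refine ⟨Y, ⟨?_, fun s r => ?_, ?_⟩, hY⟩
  · refine Measure.ext_of_charFun (funext fun t => ?_)
    rw [hY, charFun_dirac]
    simp
  · refine Measure.ext_of_charFun (funext fun t => ?_)
    rw [charFun_conv, hY, hY, hY, ← Complex.exp_add]
    push_cast
    ring_nf
  · refine continuous_iff_seqContinuous.2 fun s s₀ hs => ?_
    refine ProbabilityMeasure.tendsto_of_tendsto_charFun fun t => ?_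
    simp only [Function.comp_apply, hY]
    have hc : Continuous fun s : ℝ≥0 => Complex.exp (((s : ℝ) : ℂ) * levyExponent a m t) := by
      fun_prop
    exact (hc.tendsto s₀).comp hs

lemma IsLevySemigroup.isInfinitelyDivisible {Y : ℝ≥0 → ProbabilityMeasure ℝ}
    (hY : IsLevySemigroup Y) : IsInfinitelyDivisible (Y 1) := by
  intro n hn
  obtain ⟨η, -, -, hη⟩ := hY.exists_exponent
  refine ⟨Y (n : ℝ≥0)⁻¹, probabilityMeasure_ext_of_charFun fun t => ?_⟩
  have hn0 : (n : ℂ) ≠ 0 := by exact_mod_cast (by omega : n ≠ 0)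
  rw [charFun_lawOfSum]
  simp only [mul_one, hη, Finset.prod_const, Finset.card_univ, Fintype.card_fin]
  rw [← Complex.exp_nat_mul]
  congr 1
  push_cast
  field_simp

/-! ### The random integral -/

/-- The exponent of `∫_{(0,1]} t dY(τ_k(t))` when `Y(1)` has exponent `ψ`. -/
noncomputable def timeExponent (k : ℕ) (ψ : ℝ → ℂ) (u : ℝ) : ℂ := ∫ v, ψ (u * v) ∂timeMeasure k

lemma timeExponent_zero (k : ℕ) {ψ : ℝ → ℂ} (h0 : ψ 0 = 0) : timeExponent k ψ 0 = 0 := by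
  simp [timeExponent, h0]

lemma exists_norm_le_of_continuous {ψ : ℝ → ℂ} (hψ : Continuous ψ) (R : ℝ) :
    ∃ C, ∀ y, |y| ≤ R → ‖ψ y‖ ≤ C := by
  obtain ⟨C, hC⟩ := (isCompact_Icc (a := -R) (b := R)).exists_bound_of_continuousOn hψ.continuousOn
  exact ⟨C, fun y hy => hC y (abs_le.1 hy)⟩

lemma abs_mul_le_of_mem_Ioc (u : ℝ) {v : ℝ} (hv : v ∈ Set.Ioc (0 : ℝ) 1) : |u * v| ≤ |u| := by
  rw [abs_mul, abs_of_pos hv.1]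
  exact mul_le_of_le_one_right (abs_nonneg u) hv.2

lemma continuous_timeExponent (k : ℕ) {ψ : ℝ → ℂ} (hψ : Continuous ψ) :
    Continuous (timeExponent k ψ) := by
  rw [continuous_iff_continuousAt]
  intro u₀
  obtain ⟨C, hC⟩ := exists_norm_le_of_continuous hψ (|u₀| + 1)
  refine continuousAt_of_dominated (bound := fun _ => C)
    (Eventually.of_forall fun u => Continuous.aestronglyMeasurable (by fun_prop)) ?_
    (integrable_const _) (Eventually.of_forall fun v => by fun_prop)
  have : ∀ᶠ u : ℝ in 𝓝 u₀, |u| < |u₀| + 1 :=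
    (continuous_abs.tendsto u₀).eventually_lt_const (by linarith)
  filter_upwards [this] with u hu
  filter_upwards [ae_mem_Ioc_timeMeasure k] with v hv
  exact hC _ ((abs_mul_le_of_mem_Ioc u hv).trans hu.le)

lemma natCeil_div_mem {n : ℕ} (hn : 0 < n) {v : ℝ} (hv : v ∈ Set.Ioc (0 : ℝ) 1) :
    ((⌈v * n⌉₊ : ℝ) / n) ∈ Set.Ioc (0 : ℝ) 1 := by
  have hn' : (0 : ℝ) < n := by exact_mod_cast hn
  have h1 : 0 < ⌈v * n⌉₊ := Nat.ceil_pos.2 (mul_pos hv.1 hn')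
  refine ⟨by positivity, ?_⟩
  rw [div_le_one hn']
  have : ⌈v * n⌉₊ ≤ n := Nat.ceil_le.2 (mul_le_of_le_one_left hn'.le hv.2)
  exact_mod_cast this

lemma integrable_comp_natCeil (k : ℕ) {ψ : ℝ → ℂ} (hψ : Continuous ψ) (u : ℝ) {n : ℕ}
    (hn : 0 < n) : Integrable (fun v : ℝ => ψ (u * ((⌈v * n⌉₊ : ℝ) / n))) (timeMeasure k) := by
  obtain ⟨C, hC⟩ := exists_norm_le_of_continuous hψ |u|
  refine integrable_timeMeasure_of_norm_le ?_ C fun v hv =>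
    hC _ (abs_mul_le_of_mem_Ioc u (natCeil_div_mem hn hv))
  have hm : Measurable fun v : ℝ => u * ((⌈v * n⌉₊ : ℝ) / n) := by fun_prop
  exact (hψ.measurable.comp hm).aestronglyMeasurable

/-- The integrand is sampled at right endpoints of cells (j/n, (j+1)/n], and ⌈vn⌉/n is the right
endpoint of the cell containing v. The exponent of the sum is thus the integral of a step function,
to which dominated convergence applies. -/
lemma sum_timeChange_eq_integral (k : ℕ) {ψ : ℝ → ℂ} (hψ : Continuous ψ) (u : ℝ) {n : ℕ}
    (hn : 0 < n) :
    ∑ j : Fin n, (((timeChange k (partitionPoint 0 1 n ((j : ℕ) + 1))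
        - timeChange k (partitionPoint 0 1 n j)).toNNReal : ℝ) : ℂ)
        * ψ (u * partitionPoint 0 1 n ((j : ℕ) + 1))
      = ∫ v : ℝ, ψ (u * ((⌈v * n⌉₊ : ℝ) / n)) ∂timeMeasure k := by
  have hn' : (0 : ℝ) < n := by exact_mod_cast hn
  set p : ℕ → ℝ := fun j => (j : ℝ) / n with hp
  have hpp : ∀ j : ℕ, partitionPoint 0 1 n j = p j := fun j => by simp [partitionPoint, hp]
  have hmono : ∀ j : ℕ, p j ≤ p (j + 1) := fun j => by
    simp only [hp]
    gcongr
    exact Nat.le_succ j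
  have hI := integrable_comp_natCeil k hψ u hn
  have hterm : ∀ j < n, (((timeChange k (p (j + 1)) - timeChange k (p j)).toNNReal : ℝ) : ℂ)
      * ψ (u * p (j + 1))
      = ∫ v in p j..p (j + 1), ψ (u * ((⌈v * n⌉₊ : ℝ) / n)) ∂timeMeasure k := by
    intro j hj
    have h1 : p (j + 1) ≤ 1 := by
      simp only [hp]
      rw [div_le_one hn']
      exact_mod_cast hj
    rw [timeChange_sub k (by simp only [hp]; positivity) (hmono j) h1,
      Real.coe_toNNReal _ measureReal_nonneg, intervalIntegral.integral_of_le (hmono j),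
      setIntegral_congr_fun (g := fun _ => ψ (u * p (j + 1))) measurableSet_Ioc, setIntegral_const,
      Complex.real_smul]
    intro v hv
    have hc : ⌈v * n⌉₊ = j + 1 := by
      rw [Nat.ceil_eq_iff (Nat.succ_ne_zero j)]
      simp only [hp] at hv
      have h2 := (div_lt_iff₀ hn').1 hv.1
      have h3 := (le_div_iff₀ hn').1 hv.2
      exact ⟨by simpa using h2, h3⟩
    simp only [hc, hp]
  calc _ = ∑ j : Fin n, (((timeChange k (p ((j : ℕ) + 1)) - timeChange k (p j)).toNNReal : ℝ) : ℂ)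
        * ψ (u * p ((j : ℕ) + 1)) := by
        refine Finset.sum_congr rfl fun j _ => ?_
        rw [← hpp, ← hpp]
    _ = ∑ j ∈ Finset.range n,
          ∫ v in p j..p (j + 1), ψ (u * ((⌈v * n⌉₊ : ℝ) / n)) ∂timeMeasure k := by
        rw [Finset.sum_range]
        exact Finset.sum_congr rfl fun j _ => hterm j j.2
    _ = ∫ v in p 0..p n, ψ (u * ((⌈v * n⌉₊ : ℝ) / n)) ∂timeMeasure k :=
        intervalIntegral.sum_integral_adjacent_intervals fun j _ => hI.intervalIntegrable
    _ = ∫ v in Set.Ioc 0 1, ψ (u * ((⌈v * n⌉₊ : ℝ) / n)) ∂timeMeasure k := by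
        have h0 : p 0 = 0 := by simp [hp]
        have h1 : p n = 1 := by simp [hp, hn'.ne']
        rw [h0, h1, intervalIntegral.integral_of_le zero_le_one]
    _ = _ := by
        rw [Measure.restrict_eq_self_of_ae_mem (ae_mem_Ioc_timeMeasure k)]

lemma tendsto_integral_natCeil (k : ℕ) {ψ : ℝ → ℂ} (hψ : Continuous ψ) (u : ℝ) :
    Tendsto (fun n : ℕ => ∫ v : ℝ, ψ (u * ((⌈v * n⌉₊ : ℝ) / n)) ∂timeMeasure k) atTop
      (𝓝 (timeExponent k ψ u)) := by
  obtain ⟨C, hC⟩ := exists_norm_le_of_continuous hψ |u|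
  refine tendsto_integral_filter_of_dominated_convergence (fun _ => C) ?_ ?_ (integrable_const _) ?_
  · filter_upwards [eventually_gt_atTop 0] with n hn
    exact (integrable_comp_natCeil k hψ u hn).aestronglyMeasurable
  · filter_upwards [eventually_gt_atTop 0] with n hn
    filter_upwards [ae_mem_Ioc_timeMeasure k] with v hv
    exact hC _ (abs_mul_le_of_mem_Ioc u (natCeil_div_mem hn hv))
  · filter_upwards [ae_mem_Ioc_timeMeasure k] with v hv
    have h1 : Tendsto (fun n : ℕ => (⌈v * n⌉₊ : ℝ) / n) atTop (𝓝 v) :=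
      (tendsto_nat_ceil_mul_div_atTop hv.1.le).comp tendsto_natCast_atTop_atTop
    exact (hψ.tendsto _).comp (h1.const_mul u)

lemma tendsto_charFun_riemannSumLaw (k : ℕ) {Y : ℝ≥0 → ProbabilityMeasure ℝ} {ψ : ℝ → ℂ}
    (hψ : Continuous ψ) (h : ∀ s t, charFun (Y s : Measure ℝ) t = Complex.exp (s * ψ t)) (u : ℝ) :
    Tendsto (fun n : ℕ => charFun
      (riemannSumLaw (fun t => t) (timeChange k) 0 1 Y n : Measure ℝ) u) atTop
      (𝓝 (Complex.exp (timeExponent k ψ u))) := by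
  refine ((Complex.continuous_exp.tendsto _).comp (tendsto_integral_natCeil k hψ u)).congr' ?_
  filter_upwards [eventually_gt_atTop 0] with n hn
  rw [riemannSumLaw, charFun_lawOfSum, Function.comp_apply, ← sum_timeChange_eq_integral k hψ u hn,
    Complex.exp_sum]
  exact Finset.prod_congr rfl fun j _ => (h _ _).symm

lemma charFun_of_tendsto_riemannSumLaw (k : ℕ) {Y : ℝ≥0 → ProbabilityMeasure ℝ}
    (hY : IsLevySemigroup Y) {ψ : ℝ → ℂ} (hψ : Continuous ψ) (hψ0 : ψ 0 = 0)
    (h : ∀ t, charFun (Y 1 : Measure ℝ) t = Complex.exp (ψ t)) {ν : ProbabilityMeasure ℝ}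
    (hν : Tendsto (fun n : ℕ => riemannSumLaw (fun t => t) (timeChange k) 0 1 Y n) atTop (𝓝 ν))
    (u : ℝ) : charFun (ν : Measure ℝ) u = Complex.exp (timeExponent k ψ u) :=
  tendsto_nhds_unique (tendsto_charFun_of_tendsto hν u)
    (tendsto_charFun_riemannSumLaw k hψ (hY.charFun_eq_exp hψ hψ0 h) u)

/-- The limiting exponent is continuous, so Lévy's continuity theorem provides the limit law: the
random integral always exists. -/
lemma exists_mem_sSelfdecomposable (k : ℕ) (a : ℝ) (m : Measure ℝ) [IsFiniteMeasure m] :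
    ∃ ν ∈ sSelfdecomposable k, ∀ u, charFun (ν : Measure ℝ) u
      = Complex.exp (timeExponent k (levyExponent a m) u) := by
  obtain ⟨Y, hY, hYc⟩ := exists_isLevySemigroup a m
  have hψ := continuous_levyExponent a m
  obtain ⟨ν, hν, hνc⟩ := exists_tendsto_of_tendsto_charFun
    ((continuous_timeExponent k hψ).cexp.continuousAt)
    (tendsto_charFun_riemannSumLaw k hψ hYc)
  exact ⟨ν, ⟨Y 1, hY.isInfinitelyDivisible, Y, hY, rfl, hν⟩, hνc⟩

lemma exists_charFun_eq_of_mem_sSelfdecomposable {k : ℕ} {ν : ProbabilityMeasure ℝ}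
    (hν : ν ∈ sSelfdecomposable k) :
    ∃ (a : ℝ) (m : Measure ℝ), IsFiniteMeasure m ∧ ∀ u, charFun (ν : Measure ℝ) u
      = Complex.exp (timeExponent k (levyExponent a m) u) := by
  obtain ⟨μ, -, Y, hY, -, hlim⟩ := hν
  obtain ⟨a, m, hm, hc⟩ := hY.exists_levyExponent
  exact ⟨a, m, hm, charFun_of_tendsto_riemannSumLaw k hY (continuous_levyExponent a m)
    (levyExponent_zero a m) hc hlim⟩

/-! ### The Laplace transform of the exponent -/

lemma integrableOn_ofReal_pow_mul_cexp (p : ℕ) {t : ℝ} (ht : 0 < t) :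
    IntegrableOn (fun u : ℝ => (u : ℂ) ^ p * Complex.exp (-(t * u : ℂ))) (Set.Ioi 0) := by
  have := (integrableOn_pow_mul_exp p ht).ofReal (𝕜 := ℂ)
  refine this.congr (Eventually.of_forall fun u => ?_)
  simp

lemma integral_ofReal_pow_mul_cexp (p : ℕ) {t : ℝ} (ht : 0 < t) :
    ∫ u in Set.Ioi (0 : ℝ), (u : ℂ) ^ p * Complex.exp (-(t * u : ℂ))
      = (p.factorial : ℂ) / (t : ℂ) ^ (p + 1) := by
  have := congrArg (fun r : ℝ => (r : ℂ)) (integral_pow_mul_exp p ht)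
  simp only [← integral_complex_ofReal] at this
  push_cast at this
  exact this

/-- For x = 0 only ∫ u² e^(-tu) du = 2/t³ enters. For x ≠ 0 the three terms of the kernel transform
to 1/(t + ivx), 1/t and a multiple of 1/t², and the rest is algebra. -/
lemma laplace_levyKernel {t : ℝ} (ht : 0 < t) (v x : ℝ) :
    Complex.I * (t : ℂ) ^ 2 *
        ∫ u in Set.Ioi (0 : ℝ), levyKernel (-u * v) x * Complex.exp (-(t * u : ℂ))
      = dilationKernel t v x := by
  have htc : (t : ℂ) ≠ 0 := by exact_mod_cast ht.ne'
  by_cases hx : x = 0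
  · subst hx
    have h1 : ∀ u : ℝ, levyKernel (-u * v) 0 * Complex.exp (-(t * u : ℂ))
        = -(v : ℂ) ^ 2 / 2 * ((u : ℂ) ^ 2 * Complex.exp (-(t * u : ℂ))) := fun u => by
      rw [levyKernel, if_pos rfl]
      push_cast
      ring
    simp_rw [h1]
    rw [integral_const_mul, integral_ofReal_pow_mul_cexp 2 ht, dilationKernel]
    simp only [Complex.ofReal_zero, mul_zero, zero_div, add_zero, div_one, zero_sub]
    norm_num [Nat.factorial]
    field_simp
  · have hxc : (x : ℂ) ≠ 0 := by exact_mod_cast hx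
    have hx2 := one_add_sq_ne_zero x
    have hre : (-(t + Complex.I * v * x) : ℂ).re < 0 := by simpa using ht
    have hd0 : (t : ℂ) + Complex.I * v * x ≠ 0 := fun h => by
      rw [h] at hre
      simp at hre
    have h1 : ∀ u : ℝ, levyKernel (-u * v) x * Complex.exp (-(t * u : ℂ))
        = (1 + (x : ℂ) ^ 2) / (x : ℂ) ^ 2
            * (Complex.exp (-(t + Complex.I * v * x) * u)
              - (u : ℂ) ^ 0 * Complex.exp (-(t * u : ℂ))
              + Complex.I * v * x / (1 + (x : ℂ) ^ 2)
                * ((u : ℂ) ^ 1 * Complex.exp (-(t * u : ℂ)))) := fun u => by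
      have e : Complex.exp (-(t + Complex.I * v * x) * u)
          = Complex.exp (Complex.I * ((-u * v : ℝ) : ℂ) * x) * Complex.exp (-(t * u : ℂ)) := by
        rw [← Complex.exp_add]
        congr 1
        push_cast
        ring
      rw [levyKernel, if_neg hx, e]
      push_cast
      ring
    have i1 : IntegrableOn (fun u : ℝ => Complex.exp (-(t + Complex.I * v * x) * u))
        (Set.Ioi 0) := integrableOn_exp_mul_complex_Ioi hre 0
    have i2 := integrableOn_ofReal_pow_mul_cexp 0 ht
    have i3 := (integrableOn_ofReal_pow_mul_cexp 1 ht).const_mul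
      (Complex.I * v * x / (1 + (x : ℂ) ^ 2))
    have i4 : IntegrableOn (fun u : ℝ => Complex.exp (-(t + Complex.I * v * x) * u)
        - (u : ℂ) ^ 0 * Complex.exp (-(t * u : ℂ))) (Set.Ioi 0) := i1.sub i2
    simp_rw [h1]
    rw [integral_const_mul, integral_add i4 i3, integral_sub i1 i2, integral_const_mul,
      integral_exp_mul_complex_Ioi hre, integral_ofReal_pow_mul_cexp 0 ht,
      integral_ofReal_pow_mul_cexp 1 ht, dilationKernel]
    have hs : 1 + Complex.I * v * x / t = (t + Complex.I * v * x) / t := by field_simp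
    rw [hs]
    simp only [Complex.ofReal_zero, mul_zero, Complex.exp_zero, Nat.factorial, Nat.cast_one,
      zero_add, pow_one, mul_one, neg_div_neg_eq]
    obtain ⟨D, hD⟩ : ∃ D : ℂ, D = t + Complex.I * v * x := ⟨_, rfl⟩
    rw [← hD] at hd0 ⊢
    field_simp
    rw [hD]
    linear_combination ((t : ℂ) ^ 2 * x ^ 2 * v ^ 2 * Complex.I - (t : ℂ) ^ 3 * x ^ 3 * v)
      * Complex.I_sq

lemma timeExponent_levyExponent {k : ℕ} (hk : 1 ≤ k) (a : ℝ) (m : Measure ℝ) [IsFiniteMeasure m]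
    (u : ℝ) :
    timeExponent k (levyExponent a m) u = Complex.I * u * a / 2 ^ k
      + ∫ p, levyKernel (u * p.1) p.2 ∂(timeMeasure k).prod m := by
  have hmeas : Measurable fun p : ℝ × ℝ => levyKernel (u * p.1) p.2 :=
    measurable_levyKernel.comp ((measurable_fst.const_mul u).prodMk measurable_snd)
  have hae : ∀ᵐ p ∂(timeMeasure k).prod m, p.1 ∈ Set.Ioc (0 : ℝ) 1 :=
    Measure.quasiMeasurePreserving_fst.ae (ae_mem_Ioc_timeMeasure k)
  have hint : Integrable (fun p : ℝ × ℝ => levyKernel (u * p.1) p.2) ((timeMeasure k).prod m) := by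
    refine Integrable.of_bound hmeas.aestronglyMeasurable (7 * (1 + |u| ^ 2)) ?_
    filter_upwards [hae] with p hp
    refine (norm_levyKernel_le _ _).trans ?_
    rw [← sq_abs (u * p.1)]
    have := abs_mul_le_of_mem_Ioc u hp
    gcongr
  have h1 := integral_ofReal_pow_timeMeasure hk 1
  have hi : Integrable (fun v : ℝ => Complex.I * ((u * v : ℝ) : ℂ) * a) (timeMeasure k) := by
    refine integrable_timeMeasure_of_norm_le (Measurable.aestronglyMeasurable (by fun_prop))
      (|u| * |a|) fun v hv => ?_
    rw [norm_I_mul_mul]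
    have := abs_mul_le_of_mem_Ioc u hv
    gcongr
  have h2 : ∀ v : ℝ, Complex.I * ((u * v : ℝ) : ℂ) * a = Complex.I * u * a * (v : ℂ) ^ 1 :=
    fun v => by
      push_cast
      ring
  rw [integral_prod _ hint, timeExponent]
  simp only [levyExponent]
  rw [integral_add hi hint.integral_prod_left]
  congr 1
  simp_rw [h2]
  rw [integral_const_mul, h1]
  norm_num
  ring

lemma norm_timeExponent_levyExponent_le (k : ℕ) (a : ℝ) (m : Measure ℝ) [IsFiniteMeasure m]
    (u : ℝ) :
    ‖timeExponent k (levyExponent a m) u‖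
      ≤ (|a| + 7 * m.real Set.univ) * (1 + u ^ 2) * (timeMeasure k).real Set.univ := by
  refine norm_integral_le_of_norm_le_const ?_
  filter_upwards [ae_mem_Ioc_timeMeasure k] with v hv
  refine (norm_levyExponent_le a m _).trans ?_
  rw [← sq_abs (u * v), ← sq_abs u]
  have := abs_mul_le_of_mem_Ioc u hv
  gcongr

lemma integrableOn_one_add_sq_mul_exp {t : ℝ} (ht : 0 < t) :
    IntegrableOn (fun u : ℝ => (1 + u ^ 2) * Real.exp (-(t * u))) (Set.Ioi 0) := by
  refine ((integrableOn_pow_mul_exp 0 ht).add (integrableOn_pow_mul_exp 2 ht)).congr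
    (Eventually.of_forall fun u => ?_)
  simp only [Pi.add_apply, pow_zero]
  ring

lemma norm_cexp_neg_mul (t u : ℝ) : ‖Complex.exp (-(t * u : ℂ))‖ = Real.exp (-(t * u)) := by
  rw [Complex.norm_exp]
  simp

lemma integrableOn_timeExponent (k : ℕ) (a : ℝ) (m : Measure ℝ) [IsFiniteMeasure m] {t : ℝ}
    (ht : 0 < t) :
    IntegrableOn (fun u : ℝ => timeExponent k (levyExponent a m) (-u)
      * Complex.exp (-(t * u : ℂ))) (Set.Ioi 0) := by
  have hc := continuous_timeExponent k (continuous_levyExponent a m)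
  refine Integrable.mono' ((integrableOn_one_add_sq_mul_exp ht).const_mul
    ((|a| + 7 * m.real Set.univ) * (timeMeasure k).real Set.univ))
    (Continuous.aestronglyMeasurable (by fun_prop)) (Eventually.of_forall fun u => ?_)
  rw [norm_mul, norm_cexp_neg_mul]
  have := norm_timeExponent_levyExponent_le k a m (-u)
  rw [neg_sq] at this
  calc _ ≤ (|a| + 7 * m.real Set.univ) * (1 + u ^ 2) * (timeMeasure k).real Set.univ
        * Real.exp (-(t * u)) := by gcongr
    _ = _ := by ring

/-- Justifies Fubini in (u, v, x): since v ≤ 1, the function 7(1 + u²)e^(-tu) dominates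
independently of v and x. -/
lemma integrable_levyKernel_mul_cexp (k : ℕ) (m : Measure ℝ) [IsFiniteMeasure m] {t : ℝ}
    (ht : 0 < t) :
    Integrable (fun q : ℝ × (ℝ × ℝ) => levyKernel (-q.1 * q.2.1) q.2.2
      * Complex.exp (-(t * q.1 : ℂ)))
      ((volume.restrict (Set.Ioi 0)).prod ((timeMeasure k).prod m)) := by
  have hdom : Integrable (fun q : ℝ × (ℝ × ℝ) => (1 + q.1 ^ 2) * Real.exp (-(t * q.1)) * 7)
      ((volume.restrict (Set.Ioi 0)).prod ((timeMeasure k).prod m)) :=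
    Integrable.mul_prod (f := fun u : ℝ => (1 + u ^ 2) * Real.exp (-(t * u)))
      (g := fun _ : ℝ × ℝ => (7 : ℝ)) (integrableOn_one_add_sq_mul_exp ht) (integrable_const _)
  have hmeas : Measurable fun q : ℝ × (ℝ × ℝ) => levyKernel (-q.1 * q.2.1) q.2.2 :=
    measurable_levyKernel.comp
      ((measurable_fst.neg.mul measurable_snd.fst).prodMk measurable_snd.snd)
  have hae : ∀ᵐ q ∂(volume.restrict (Set.Ioi (0 : ℝ))).prod ((timeMeasure k).prod m),
      q.2.1 ∈ Set.Ioc (0 : ℝ) 1 :=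
    Measure.quasiMeasurePreserving_snd.ae
      (Measure.quasiMeasurePreserving_fst.ae (ae_mem_Ioc_timeMeasure k))
  refine Integrable.mono' hdom (hmeas.mul (by fun_prop)).aestronglyMeasurable ?_
  filter_upwards [hae] with q hq
  rw [norm_mul, norm_cexp_neg_mul]
  have h1 := norm_levyKernel_le (-q.1 * q.2.1) q.2.2
  have h2 : (-q.1 * q.2.1) ^ 2 ≤ q.1 ^ 2 := by
    rw [← sq_abs (-q.1 * q.2.1), ← sq_abs q.1, ← abs_neg q.1]
    have := abs_mul_le_of_mem_Ioc (-q.1) hq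
    gcongr
  calc _ ≤ 7 * (1 + q.1 ^ 2) * Real.exp (-(t * q.1)) := by
        gcongr
        linarith
    _ = _ := by ring

/-- Interchange the Laplace integral with those over v and x, then integrate the dilation kernel
over dτ_k. The drift contributes it² · (-ia/2^k) · t⁻² = a/2^k. -/
lemma laplace_timeExponent {k : ℕ} (hk : 1 ≤ k) (a : ℝ) (m : Measure ℝ) [IsFiniteMeasure m] {t : ℝ}
    (ht : 0 < t) :
    Complex.I * (t : ℂ) ^ 2 * ∫ u in Set.Ioi (0 : ℝ), timeExponent k (levyExponent a m) (-u)
        * Complex.exp (-(t * u : ℂ))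
      = (a : ℂ) / 2 ^ k + ∫ x, khintchineKernel k t x ∂m := by
  have htc : (t : ℂ) ≠ 0 := by exact_mod_cast ht.ne'
  have hI := integrable_levyKernel_mul_cexp k m ht
  have h1 : ∀ u : ℝ, timeExponent k (levyExponent a m) (-u) * Complex.exp (-(t * u : ℂ))
      = -(Complex.I * a / 2 ^ k) * ((u : ℂ) ^ 1 * Complex.exp (-(t * u : ℂ)))
        + ∫ p, levyKernel (-u * p.1) p.2 * Complex.exp (-(t * u : ℂ)) ∂(timeMeasure k).prod m :=
    fun u => by
      rw [timeExponent_levyExponent hk, integral_mul_const]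
      push_cast
      ring
  have h2 : Complex.I * (t : ℂ) ^ 2 * ∫ u in Set.Ioi (0 : ℝ), ∫ p, levyKernel (-u * p.1) p.2
      * Complex.exp (-(t * u : ℂ)) ∂(timeMeasure k).prod m
      = ∫ p, dilationKernel t p.1 p.2 ∂(timeMeasure k).prod m := by
    rw [integral_integral_swap hI, ← integral_const_mul]
    exact integral_congr_ae (Eventually.of_forall fun p => laplace_levyKernel ht p.1 p.2)
  have hdil : Integrable (fun p : ℝ × ℝ => dilationKernel t p.1 p.2) ((timeMeasure k).prod m) := by
    refine Integrable.of_bound (measurable_dilationKernel t).aestronglyMeasurable (t + 1 / t) ?_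
    filter_upwards [Measure.quasiMeasurePreserving_fst.ae (ae_mem_Ioc_timeMeasure k)] with p hp
    exact norm_dilationKernel_le ht hp p.2
  have h3 : ∫ p, dilationKernel t p.1 p.2 ∂(timeMeasure k).prod m
      = ∫ x, khintchineKernel k t x ∂m := by
    rw [integral_prod_symm _ hdil]
    simp_rw [khintchineKernel_eq_integral hk ht]
  simp_rw [h1]
  rw [integral_add ((integrableOn_ofReal_pow_mul_cexp 1 ht).const_mul _) hI.integral_prod_left,
    mul_add, h2, h3, integral_const_mul, integral_ofReal_pow_mul_cexp 1 ht]
  congr 1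
  simp only [Nat.factorial]
  field_simp
  norm_num
  ring

/-! ### Free counterparts -/

lemma VoiculescuOnAxis.congr {ν : ProbabilityMeasure ℝ} {f g : ℝ → ℂ} (hf : VoiculescuOnAxis ν f)
    (h : ∀ t, 0 < t → f t = g t) : VoiculescuOnAxis ν g := by
  obtain ⟨V, hV, hVf⟩ := hf
  exact ⟨V, hV, fun t ht => (hVf t ht).trans (h t ht)⟩

lemma voiculescuOnAxis_congr {ν : ProbabilityMeasure ℝ} {f g : ℝ → ℂ}
    (h : ∀ t, 0 < t → f t = g t) : VoiculescuOnAxis ν f ↔ VoiculescuOnAxis ν g :=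
  ⟨fun hf => hf.congr h, fun hg => hg.congr fun t ht => (h t ht).symm⟩

/-- The continuous logarithm of φ_ν is unique, so both sides prescribe the same function on the
imaginary axis. -/
lemma isFreeCounterpart_iff {k : ℕ} (hk : 1 ≤ k) {a : ℝ} {m : Measure ℝ} [IsFiniteMeasure m]
    {ν : ProbabilityMeasure ℝ}
    (hν : ∀ u, charFun (ν : Measure ℝ) u = Complex.exp (timeExponent k (levyExponent a m) u))
    (ν' : ProbabilityMeasure ℝ) :
    IsFreeCounterpart ν ν' ↔
      VoiculescuOnAxis ν' (fun t => (a : ℂ) / 2 ^ k + ∫ x : ℝ, khintchineKernel k t x ∂m) := by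
  have hc := continuous_timeExponent k (continuous_levyExponent a m)
  have h0 := timeExponent_zero k (levyExponent_zero a m)
  constructor
  · rintro ⟨ψ, ⟨hψ, hψ0, hψe⟩, -, hV⟩
    have : ψ = timeExponent k (levyExponent a m) :=
      eq_of_exp_eq_exp hψ hc (hψ0.trans h0.symm) fun u => by rw [hψe, hν]
    subst this
    exact hV.congr fun t ht => laplace_timeExponent hk a m ht
  · intro hV
    exact ⟨timeExponent k (levyExponent a m), ⟨hc, h0, fun u => (hν u).symm⟩,
      fun t ht => integrableOn_timeExponent k a m ht,
      hV.congr fun t ht => (laplace_timeExponent hk a m ht).symm⟩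

lemma IsTimeChangedIntegral.charFun_eq {k : ℕ} {μ ν : ProbabilityMeasure ℝ} {a : ℝ} {σsq : ℝ≥0}
    {M : Measure ℝ} (hμ : HasLevyTriplet μ a σsq M) (h : IsTimeChangedIntegral k μ ν) (u : ℝ) :
    charFun (ν : Measure ℝ) u
      = Complex.exp (timeExponent k (levyExponent a (khintchineMeasure σsq M)) u) := by
  obtain ⟨Y, hY, rfl, hlim⟩ := h
  have := isFiniteMeasure_khintchineMeasure σsq hμ.1
  exact charFun_of_tendsto_riemannSumLaw k hY (continuous_levyExponent _ _)
    (levyExponent_zero _ _) hμ.charFun_eq hlim u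

/-- The Lévy–Khintchine formula for the driving semigroup gives one direction; its converse, with
existence of the random integral, gives the other. -/
lemma mem_freeSSelfdecomposable_iff {k : ℕ} (hk : 1 ≤ k) (ν' : ProbabilityMeasure ℝ) :
    ν' ∈ freeSSelfdecomposable k ↔ ∃ (a : ℝ) (m : Measure ℝ), IsFiniteMeasure m ∧
      VoiculescuOnAxis ν' (fun t => (a : ℂ) / 2 ^ k + ∫ x : ℝ, khintchineKernel k t x ∂m) := by
  constructor
  · rintro ⟨ν, hν, hfree⟩
    obtain ⟨a, m, hm, hc⟩ := exists_charFun_eq_of_mem_sSelfdecomposable hν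
    exact ⟨a, m, hm, (isFreeCounterpart_iff hk hc ν').1 hfree⟩
  · rintro ⟨a, m, hm, hV⟩
    obtain ⟨ν, hν, hc⟩ := exists_mem_sSelfdecomposable k a m
    exact ⟨ν, hν, (isFreeCounterpart_iff hk hc ν').2 hV⟩

lemma voiculescuOnAxis_khintchineMeasure_iff {k : ℕ} (hk : 1 ≤ k) (a : ℝ) (σsq : ℝ≥0)
    {M : Measure ℝ} (hM : IsLevyMeasure M) (ν' : ProbabilityMeasure ℝ) :
    VoiculescuOnAxis ν' (fun t => (a : ℂ) / 2 ^ k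
        + ∫ x : ℝ, khintchineKernel k t x ∂(khintchineMeasure σsq M)) ↔
      VoiculescuOnAxis ν' (fun t => (a : ℂ) / 2 ^ k
        + ((σsq : ℝ) : ℂ) / 3 ^ k * (1 / (Complex.I * t))
        + ∫ x : ℝ, (x : ℂ) * bracket k t x ∂M) :=
  voiculescuOnAxis_congr fun t ht => by
    rw [integral_khintchineKernel hk ht σsq hM, add_assoc]

end UrbanikFree

open UrbanikFree in
theorem proposition1 (k : ℕ) (hk : 1 ≤ k) :
    -- the integrals in both formulas converge, and `m` is a finite measure
    (∀ (σsq : ℝ≥0) (M : Measure ℝ), IsLevyMeasure M →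
      IsFiniteMeasure (khintchineMeasure σsq M) ∧
      ∀ t : ℝ, 0 < t → Integrable (fun x : ℝ => (x : ℂ) * bracket k t x) M) ∧
    (∀ m : Measure ℝ, IsFiniteMeasure m →
      ∀ t : ℝ, 0 < t → Integrable (fun x : ℝ => khintchineKernel k t x) m) ∧
    -- the value at zero of the second integrand
    (∀ t : ℝ, 0 < t →
      Tendsto (fun x : ℝ => bracket k t x * ((1 + (x : ℂ) ^ 2) / x)) (𝓝[≠] 0)
        (𝓝 (1 / (3 ^ k * (Complex.I * t))))) ∧
    -- for a given background driving measure `μ = [a, σ², M]` and `ν` its random integral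
    (∀ (a : ℝ) (σsq : ℝ≥0) (M : Measure ℝ) (μ ν : ProbabilityMeasure ℝ),
      HasLevyTriplet μ a σsq M → IsTimeChangedIntegral k μ ν →
      ∀ ν' : ProbabilityMeasure ℝ,
        (IsFreeCounterpart ν ν' ↔
          VoiculescuOnAxis ν' (fun t => (a : ℂ) / 2 ^ k
            + ((σsq : ℝ) : ℂ) / 3 ^ k * (1 / (Complex.I * t))
            + ∫ x : ℝ, (x : ℂ) * bracket k t x ∂M)) ∧
        (IsFreeCounterpart ν ν' ↔
          VoiculescuOnAxis ν' (fun t => (a : ℂ) / 2 ^ k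
            + ∫ x : ℝ, khintchineKernel k t x ∂(khintchineMeasure σsq M)))) ∧
    -- description of the whole class of free counterparts
    (∀ ν' : ProbabilityMeasure ℝ,
      (ν' ∈ freeSSelfdecomposable k ↔
        ∃ (a : ℝ) (σsq : ℝ≥0) (M : Measure ℝ), IsLevyMeasure M ∧
          VoiculescuOnAxis ν' (fun t => (a : ℂ) / 2 ^ k
            + ((σsq : ℝ) : ℂ) / 3 ^ k * (1 / (Complex.I * t))
            + ∫ x : ℝ, (x : ℂ) * bracket k t x ∂M)) ∧
      (ν' ∈ freeSSelfdecomposable k ↔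
        ∃ (a : ℝ) (m : Measure ℝ), IsFiniteMeasure m ∧
          VoiculescuOnAxis ν' (fun t => (a : ℂ) / 2 ^ k
            + ∫ x : ℝ, khintchineKernel k t x ∂m))) := by
  have key : ∀ (a : ℝ) (σsq : ℝ≥0) (M : Measure ℝ) (μ ν : ProbabilityMeasure ℝ),
      HasLevyTriplet μ a σsq M → IsTimeChangedIntegral k μ ν → ∀ ν' : ProbabilityMeasure ℝ,
        (IsFreeCounterpart ν ν' ↔
          VoiculescuOnAxis ν' (fun t => (a : ℂ) / 2 ^ k
            + ∫ x : ℝ, khintchineKernel k t x ∂(khintchineMeasure σsq M))) := by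
    intro a σsq M μ ν hμ hν ν'
    have := isFiniteMeasure_khintchineMeasure σsq hμ.1
    exact isFreeCounterpart_iff hk (IsTimeChangedIntegral.charFun_eq hμ hν) ν'
  refine ⟨fun σsq M hM => ⟨isFiniteMeasure_khintchineMeasure σsq hM,
      fun t ht => integrable_mul_bracket hk ht hM⟩,
    fun m hm t ht => integrable_khintchineKernel hk ht m, fun t ht => tendsto_bracket_mul hk ht,
    fun a σsq M μ ν hμ hν ν' => ⟨?_, key a σsq M μ ν hμ hν ν'⟩,
    fun ν' => ⟨?_, mem_freeSSelfdecomposable_iff hk ν'⟩⟩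
  · rw [key a σsq M μ ν hμ hν ν']
    exact voiculescuOnAxis_khintchineMeasure_iff hk a σsq hμ.1 ν'
  · rw [mem_freeSSelfdecomposable_iff hk ν']
    constructor
    · rintro ⟨a, m, hm, hV⟩
      -- Every finite m comes from a pair (σ², M), so (1) loses no generality against (2).
      obtain ⟨σsq, M, hM, rfl⟩ := exists_khintchineMeasure_eq m
      exact ⟨a, σsq, M, hM, (voiculescuOnAxis_khintchineMeasure_iff hk a σsq hM ν').1 hV⟩
    · rintro ⟨a, σsq, M, hM, hV⟩
      exact ⟨a, khintchineMeasure σsq M, isFiniteMeasure_khintchineMeasure σsq hM,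
        (voiculescuOnAxis_khintchineMeasure_iff hk a σsq hM ν').2 hV⟩
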